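/- A permutation of length $n$ is a bijection $\pi$ of $\{1,\dots,n\}$, written $\pi(1)\pi(2)\cdots\pi(n)$. A \emph{block} of $\pi$ is a nonempty set of consecutive positions whose values under $\pi$ form a set of consecutive integers; $\pi$ is \emph{simple} if its only blocks are the singletons and $\{1,\dots,n\}$. For permutations $\alpha$ of length $k\ge 1$ and $\beta$ of length $m\ge 1$, let $(12)[\alpha,\beta]$ be the permutation of length $k+m$ given by $i\mapsto\alpha(i)$ for $1\le i\le k$ and $k+j\mapsto k+\beta(j)$ for $1\le j\le m$; $\pi$ is \emph{plus indecomposable} if it is not of the form $(12)[\alpha,\beta]$. For $n\ge 1$ let $s_n$ be the number of simple permutations of length $n$, let $i_n$ be the number of plus indecomposable permutations of length $n$, and let $\mathrm{Com}_n$ be the coefficient of $x^n$ in the compositional inverse $F^{\langle -1\rangle}(x)$ of the formal power series $F(x)=\sum_{k\ge 1}k!\,x^k$. A sequence $(a_n)_{n\ge 1}$ of complex numbers is \emph{P-recursive} if there are $d\ge 0$ and polynomials $p_0,\dots,p_d\in\mathbf{C}[x]$ with $p_d\ne 0$ such that $p_0(n)a_n+p_1(n)a_{n+1}+\cdots+p_d(n)a_{n+d}=0$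 for all $n\ge 1$. A formal power series $A\in\mathbf{C}[[x]]$ is \emph{D-finite} if there are $d\ge 0$ and polynomials $q_0,\dots,q_d\in\mathbf{C}[x]$ with $q_d\ne 0$ such that $q_0A+q_1A'+\cdots+q_dA^{(d)}=0$. \textbf{Corollary.} None of the sequences $(i_n)_{n\ge1}$, $(\mathrm{Com}_n)_{n\ge1}$, $(s_n)_{n\ge1}$ is P-recursive. Equivalently, none of the generating functions $\sum_{n\ge1}i_nx^n$, $\sum_{n\ge1}\mathrm{Com}_nx^n=F^{\langle-1\rangle}(x)$, $\sum_{n\ge1}s_nx^n$ is D-finite; nor is $\sum_{n\ge4}s_nx^n$. -/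

import Mathlib

open PowerSeries

noncomputable section

namespace SimplePerm

/-! ### Permutations of length `n`, i.e. elements of `Equiv.Perm (Fin n)` -/

/-- A block of `π`: a nonempty segment (set of consecutive positions) whose values form
a range (set of consecutive values). -/
def IsBlock {n : ℕ} (π : Equiv.Perm (Fin n)) (B : Set (Fin n)) : Prop :=
  (∃ a b : Fin n, a ≤ b ∧ B = Set.Icc a b) ∧ ∃ c d : Fin n, π '' B = Set.Icc c d

/-- `π` is simple if its only blocks are the singletons and the whole set of positions. -/
def IsSimple {n : ℕ} (π : Equiv.Perm (Fin n)) : Prop :=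
  ∀ B : Set (Fin n), IsBlock π B → (∃ a, B = {a}) ∨ B = Set.univ

/-- The inflation `(12)[α, β]`: the first `k` positions carry the values of `α`,
the last `m` positions carry the values of `β` increased by `k`. -/
def inflateOneTwo {k m : ℕ} (α : Equiv.Perm (Fin k)) (β : Equiv.Perm (Fin m)) :
    Equiv.Perm (Fin (k + m)) :=
  finSumFinEquiv.permCongr (Equiv.Perm.sumCongr α β)

/-- `π` cannot be written in the form `(12)[α, β]` with `α`, `β` of positive length. -/
def IsPlusIndecomposable {n : ℕ} (π : Equiv.Perm (Fin n)) : Prop :=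
  ¬ ∃ (k m : ℕ) (_ : 0 < k) (_ : 0 < m) (h : k + m = n)
      (α : Equiv.Perm (Fin k)) (β : Equiv.Perm (Fin m)),
      π = (finCongr h).permCongr (inflateOneTwo α β)

/-- `s_n`, the number of simple permutations of length `n`. -/
def numSimple (n : ℕ) : ℕ := Nat.card {π : Equiv.Perm (Fin n) // IsSimple π}

/-- `i_n`, the number of plus indecomposable permutations of length `n`. -/
def numPlusIndec (n : ℕ) : ℕ := Nat.card {π : Equiv.Perm (Fin n) // IsPlusIndecomposable π}

/-! ### Generating functions, P-recursiveness and D-finiteness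

A sequence `(a_n)_{n ≥ 1}` is represented by a function `a : ℕ → ℂ` whose value at `0`
is irrelevant. -/

/-- The ordinary generating function `∑_{n ≥ 1} a_n x^n`, with zero constant term. -/
def genFun (a : ℕ → ℂ) : ℂ⟦X⟧ := PowerSeries.mk fun n => if n = 0 then 0 else a n

/-- `(a_n)_{n ≥ 1}` is P-recursive: there are polynomials `p_0, …, p_d` with `p_d ≠ 0` and
`p_0(n) a_n + p_1(n) a_{n+1} + ⋯ + p_d(n) a_{n+d} = 0` for all `n ≥ 1`. -/
def IsPRecursive (a : ℕ → ℂ) : Prop :=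
  ∃ (d : ℕ) (p : ℕ → Polynomial ℂ), p d ≠ 0 ∧
    ∀ n : ℕ, 1 ≤ n → ∑ j ∈ Finset.range (d + 1), (p j).eval (n : ℂ) * a (n + j) = 0

/-- `f` is D-finite: there are polynomials `q_0, …, q_d` with `q_d ≠ 0` and
`q_0 f + q_1 f' + ⋯ + q_d f^{(d)} = 0`. -/
def IsDFinite (f : ℂ⟦X⟧) : Prop :=
  ∃ (d : ℕ) (q : ℕ → Polynomial ℂ), q d ≠ 0 ∧
    ∑ j ∈ Finset.range (d + 1), (q j : ℂ⟦X⟧) * (PowerSeries.derivative ℂ)^[j] f = 0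

/-! ### Comtet's sequence -/

/-- `F(x) = ∑_{k ≥ 1} k! x^k`. -/
def factorialSeries : ℂ⟦X⟧ := genFun fun n => (n.factorial : ℂ)

theorem isUnit_coeff_one_factorialSeries : IsUnit (PowerSeries.coeff 1 factorialSeries) := by
  simp [factorialSeries, genFun]

/-- `C(x) = F^{⟨-1⟩}(x)`, the functional (compositional) inverse of `F`. -/
def comtetSeries : ℂ⟦X⟧ :=
  factorialSeries.substInvOfIsUnit isUnit_coeff_one_factorialSeries

/-- `Com_n`, the coefficient of `x^n` in `F^{⟨-1⟩}(x)`. -/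
def com (n : ℕ) : ℂ := PowerSeries.coeff n comtetSeries

/-- `S(x) = ∑_{k ≥ 4} s_k x^k`. -/
def simpleSeries : ℂ⟦X⟧ := PowerSeries.mk fun n => if n < 4 then 0 else (numSimple n : ℂ)

end SimplePerm

end

noncomputable section

namespace SimplePerm

/-! ### The series `F` is not algebraic -/

/-! Two facts about `F` drive everything: it satisfies `x²F' = (1 - x)F - x`, and it is not
algebraic over `ℂ(x)` (`factorialSeries_not_isAlgebraic`). The inverse series `C` and the series `I`
of plus indecomposables, where `I(1 + F) = F`, therefore satisfy first-order equations `V(x, f) f' =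
P(x, f)` that are nonlinear in `f`. Such an equation expresses every derivative of `f` as a rational
function of `x` and `f`, so a linear differential equation for `f` turns into a polynomial relation
between `x` and `f` (`IsDFiniteModRat.isAlgebraic`). If that relation is nontrivial, `f` is
algebraic, and hence so is `F`, a contradiction.

Nontriviality has a different cause in the two cases. For `I`, the equation is of Riccati type, and
the `y`-degree of the numerator rises strictly with the order of the derivative
(`elimPoly_ne_zero_of_natDegree`). For `C`, the higher derivatives have poles of increasing order
along the root `y = x/(1 + x)` of `V` (`elimPoly_ne_zero_of_root`).

The simple permutations are reduced to `C`. A permutation of length at least two is exactly one of: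
sum decomposable, skew decomposable, or an inflation of a unique simple permutation of length `m ≥
4`; a simple permutation of length `m` has `[xⁿ]F^m` inflations of length `n`. This gives `S(F) = 2I
- F - x`, and substituting `C` gives `(1 + x)(C + S) = x - x²`. So `S` and `-C` differ by a rational
function. Allowing a rational right-hand side in the linear equations makes non-D-finiteness pass
from `C` to `S` at once.

The statements on sequences follow because a P-recursive sequence has a D-finite generating function
(`IsPRecursive.isDFinite`). -/

theorem algebraMap_eq_coe (p : Polynomial ℂ) :
    algebraMap (Polynomial ℂ) ℂ⟦X⟧ p = (p : ℂ⟦X⟧) := by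
  rw [PowerSeries.algebraMap_apply']
  simp

theorem coe_natCast (n : ℕ) : ((n : Polynomial ℂ) : ℂ⟦X⟧) = n :=
  map_natCast (Polynomial.coeToPowerSeries.ringHom (R := ℂ)) n

theorem coe_ne_zero {p : Polynomial ℂ} (hp : p ≠ 0) : (p : ℂ⟦X⟧) ≠ 0 := by
  rwa [Ne, Polynomial.coe_eq_zero_iff]

/-- Differentiation of the coefficients of a bivariate polynomial. -/
def coeffDeriv (W : Polynomial (Polynomial ℂ)) : Polynomial (Polynomial ℂ) :=
  ∑ i ∈ W.support, Polynomial.monomial i (Polynomial.derivative (W.coeff i))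

theorem coeff_coeffDeriv (W : Polynomial (Polynomial ℂ)) (i : ℕ) :
    (coeffDeriv W).coeff i = Polynomial.derivative (W.coeff i) := by
  simp only [coeffDeriv, Polynomial.finsetSum_coeff, Polynomial.coeff_monomial,
    Finset.sum_ite_eq', Polynomial.mem_support_iff]
  split_ifs with h
  · rfl
  · push Not at h
    simp [h]

theorem natDegree_coeffDeriv_le (W : Polynomial (Polynomial ℂ)) :
    (coeffDeriv W).natDegree ≤ W.natDegree := by
  rw [Polynomial.natDegree_le_iff_coeff_eq_zero]
  intro N hN
  rw [coeff_coeffDeriv, Polynomial.coeff_eq_zero_of_natDegree_lt hN, map_zero]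

/-- The chain rule for a bivariate polynomial evaluated at a power series. -/
theorem derivative_aeval (W : Polynomial (Polynomial ℂ)) (f : ℂ⟦X⟧) :
    PowerSeries.derivative ℂ (Polynomial.aeval f W) =
      Polynomial.aeval f (coeffDeriv W) +
        Polynomial.aeval f (Polynomial.derivative W) * PowerSeries.derivative ℂ f := by
  conv_lhs => rw [Polynomial.aeval_def, Polynomial.eval₂_eq_sum, Polynomial.sum_def, map_sum]
  rw [Polynomial.derivative_apply, Polynomial.sum_def, coeffDeriv, map_sum, map_sum,
    Finset.sum_mul, ← Finset.sum_add_distrib]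
  refine Finset.sum_congr rfl fun i _ => ?_
  rw [Derivation.leibniz, algebraMap_eq_coe, derivative_coe, Polynomial.aeval_monomial,
    algebraMap_eq_coe, derivative_pow]
  simp only [map_mul, Polynomial.aeval_C, algebraMap_eq_coe, map_pow, Polynomial.aeval_X,
    smul_eq_mul, map_natCast]
  ring

theorem coeff_genFun_of_pos (a : ℕ → ℂ) {n : ℕ} (hn : n ≠ 0) : coeff n (genFun a) = a n := by
  simp [genFun, hn]

theorem coeff_zero_genFun (a : ℕ → ℂ) : coeff 0 (genFun a) = 0 := by
  simp [genFun]

theorem constantCoeff_factorialSeries : constantCoeff factorialSeries = 0 := by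
  rw [← coeff_zero_eq_constantCoeff_apply]
  exact coeff_zero_genFun _

theorem coeff_factorialSeries {n : ℕ} (hn : n ≠ 0) :
    coeff n factorialSeries = (n.factorial : ℂ) :=
  coeff_genFun_of_pos _ hn

theorem derivative_factorialSeries :
    X ^ 2 * PowerSeries.derivative ℂ factorialSeries = (1 - X) * factorialSeries - X := by
  ext n
  rcases n with _ | _ | n
  · simp [constantCoeff_factorialSeries]
  · rw [sub_mul, one_mul, map_sub, map_sub, coeff_succ_X_mul, coeff_X_pow_mul']
    simp [coeff_factorialSeries, constantCoeff_factorialSeries]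
  · rw [sub_mul, one_mul, map_sub, map_sub, coeff_succ_X_mul, coeff_X_pow_mul',
      coeff_derivative, coeff_X]
    have h : ¬ (n + 1 + 1 = 1) := by omega
    simp only [h, if_false, show 2 ≤ n + 1 + 1 by omega, if_true,
      show n + 1 + 1 - 2 = n by omega]
    rw [coeff_factorialSeries (by omega), coeff_factorialSeries (by omega)]
    simp only [Nat.factorial_succ]
    push_cast
    ring

theorem factorialSeries_ne_coe (p : Polynomial ℂ) : factorialSeries ≠ p := by
  intro h
  have := congrArg (coeff (p.natDegree + 1)) h
  rw [coeff_factorialSeries (by omega), Polynomial.coeff_coe,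
    Polynomial.coeff_eq_zero_of_natDegree_lt (by omega)] at this
  exact Nat.factorial_ne_zero _ (by exact_mod_cast this)

/-- `F` is not a rational function. -/
theorem coe_mul_factorialSeries_ne (p : Polynomial ℂ) :
    ∀ q : Polynomial ℂ, q ≠ 0 → (q : ℂ⟦X⟧) * factorialSeries ≠ p := by
  suffices H : ∀ (n : ℕ) (q p : Polynomial ℂ), q.natDegree = n → q ≠ 0 →
      (q : ℂ⟦X⟧) * factorialSeries ≠ p from fun q hq => H _ q p rfl hq
  intro n
  induction n with
  | zero =>
    intro q p hn hq h
    obtain ⟨c, rfl⟩ := Polynomial.natDegree_eq_zero.mp hn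
    have hc : c ≠ 0 := fun h => hq (by simp [h])
    refine factorialSeries_ne_coe (Polynomial.C c⁻¹ * p) ?_
    rw [Polynomial.coe_mul, ← h, ← mul_assoc, ← Polynomial.coe_mul, ← Polynomial.C_mul,
      inv_mul_cancel₀ hc]
    simp
  | succ n ih =>
    intro q p hn hq h
    have h1 := congrArg (PowerSeries.derivative ℂ) h
    rw [Derivation.leibniz, derivative_coe, derivative_coe, smul_eq_mul, smul_eq_mul] at h1
    -- Eliminating `F'` by the differential equation leaves `F` only in the combination `qF = p`, so
    -- `q'F` times `X²` is a polynomial. It is divisible by `X²`, hence `q'` is again a denominator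
    -- of `F`, of smaller degree: a descent to the constant case.
    have h2 : (X : ℂ⟦X⟧) ^ 2 * ((Polynomial.derivative q : Polynomial ℂ) * factorialSeries) =
        ((Polynomial.X ^ 2 * Polynomial.derivative p - (1 - Polynomial.X) * p
          + Polynomial.X * q : Polynomial ℂ) : ℂ⟦X⟧) := by
      push_cast
      rw [← h1, ← h]
      linear_combination -(q : ℂ⟦X⟧) * derivative_factorialSeries
    obtain ⟨r, hr⟩ : Polynomial.X ^ 2 ∣ (Polynomial.X ^ 2 * Polynomial.derivative p -
        (1 - Polynomial.X) * p + Polynomial.X * q : Polynomial ℂ) := by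
      rw [Polynomial.X_pow_dvd_iff]
      intro d hd
      rw [← Polynomial.coeff_coe, ← h2]
      exact X_pow_dvd_iff.mp (dvd_mul_right _ _) d hd
    refine ih (Polynomial.derivative q) r ?_ ?_ ?_
    · rw [Polynomial.natDegree_derivative]; omega
    · intro h0
      have := Polynomial.derivative_eq_zero.mp h0
      omega
    · rw [hr] at h2
      push_cast at h2
      exact mul_left_cancel₀ (pow_ne_zero 2 X_ne_zero) h2

/-- A nonzero power series does not satisfy the homogeneous equation
`x²(E'q - Eq') = (1 - x)Eq`. -/
theorem eq_zero_of_homogeneous {E q : ℂ⟦X⟧} (hq : q ≠ 0)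
    (h : X ^ 2 * (PowerSeries.derivative ℂ E * q - E * PowerSeries.derivative ℂ q) =
      (1 - X) * E * q) : E = 0 := by
  by_contra hE
  obtain ⟨e, E, hE0, rfl⟩ : ∃ (e : ℕ) (E' : ℂ⟦X⟧), constantCoeff E' ≠ 0 ∧ E = X ^ e * E' := by
    obtain ⟨E', hE'⟩ := X_pow_order_dvd (φ := E)
    refine ⟨E.order.toNat, E', fun h0 => ?_, hE'⟩
    obtain ⟨E'', hE''⟩ := X_dvd_iff.mpr h0
    have := (X_pow_dvd_iff (φ := E) (n := E.order.toNat + 1)).mp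
      ⟨E'', by rw [pow_succ, mul_assoc, ← hE'', ← hE']⟩ E.order.toNat (by omega)
    exact coeff_order hE this
  obtain ⟨k, q, hq0, rfl⟩ : ∃ (e : ℕ) (E' : ℂ⟦X⟧), constantCoeff E' ≠ 0 ∧ q = X ^ e * E' := by
    obtain ⟨E', hE'⟩ := X_pow_order_dvd (φ := q)
    refine ⟨q.order.toNat, E', fun h0 => ?_, hE'⟩
    obtain ⟨E'', hE''⟩ := X_dvd_iff.mpr h0
    have := (X_pow_dvd_iff (φ := q) (n := q.order.toNat + 1)).mp
      ⟨E'', by rw [pow_succ, mul_assoc, ← hE'', ← hE']⟩ q.order.toNat (by omega)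
    exact coeff_order hq this
  have hX (n : ℕ) : (X : ℂ⟦X⟧) * PowerSeries.derivative ℂ (X ^ n) = (n : ℂ⟦X⟧) * X ^ n := by
    rw [derivative_pow, derivative_X]
    rcases n with _ | n
    · simp
    · simp [pow_succ]; ring
  have h3 : X ^ (e + k) * (X * (X * (PowerSeries.derivative ℂ E * q -
      E * PowerSeries.derivative ℂ q) + ((e : ℂ⟦X⟧) - (k : ℂ⟦X⟧)) * E * q)) =
      X ^ (e + k) * ((1 - X) * E * q) := by
    rw [Derivation.leibniz, Derivation.leibniz] at h
    simp only [smul_eq_mul] at h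
    linear_combination h - X * E * q * X ^ k * hX e + X * E * q * X ^ e * hX k
  -- With the powers of `X` split off, the left side is divisible by `X`, while the right side has
  -- constant term `E(0)q(0) ≠ 0`.
  have h4 := congrArg constantCoeff (mul_left_cancel₀ (pow_ne_zero (e + k) (X_ne_zero (R := ℂ))) h3)
  simp only [map_mul, constantCoeff_X, zero_mul, map_sub, map_one, sub_zero, one_mul] at h4
  exact mul_ne_zero hE0 hq0 h4.symm

theorem factorialSeries_not_isAlgebraic :
    ¬ IsAlgebraic (Polynomial ℂ) factorialSeries := by
  classical
  rintro ⟨W₀, hW₀, hW₀F⟩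
  have hex : ∃ n : ℕ, ∃ W : Polynomial (Polynomial ℂ), W ≠ 0 ∧
      Polynomial.aeval factorialSeries W = 0 ∧ W.natDegree = n := ⟨_, W₀, hW₀, hW₀F, rfl⟩
  obtain ⟨W, hW, hWF, hn⟩ := Nat.find_spec hex
  have hmin : ∀ V : Polynomial (Polynomial ℂ), Polynomial.aeval factorialSeries V = 0 →
      V.natDegree < W.natDegree → V = 0 := by
    intro V hV hlt
    by_contra hV0
    exact Nat.find_min hex (hn ▸ hlt) ⟨V, hV0, hV, rfl⟩
  clear hn
  obtain ⟨n, hn⟩ : ∃ n, W.natDegree = n + 1 := by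
    rcases h : W.natDegree with _ | n
    · obtain ⟨c, rfl⟩ := Polynomial.natDegree_eq_zero.mp h
      rw [Polynomial.aeval_C, algebraMap_eq_coe] at hWF
      exact absurd hWF (coe_ne_zero fun h0 => hW (by simp [h0]))
    · exact ⟨n, rfl⟩
  set L : Polynomial (Polynomial ℂ) := Polynomial.C (1 - Polynomial.X) * Polynomial.X -
    Polynomial.C Polynomial.X with hL
  -- `L(F) = X²F'`, so `V(F)` is `X²` times the derivative of `W(F) = 0`.
  set V : Polynomial (Polynomial ℂ) := Polynomial.C (Polynomial.X ^ 2) * coeffDeriv W +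
    Polynomial.derivative W * L with hV
  have hVF : Polynomial.aeval factorialSeries V = 0 := by
    have h1 := derivative_aeval W factorialSeries
    rw [hWF, map_zero] at h1
    simp only [hV, hL, map_add, map_sub, map_mul, Polynomial.aeval_C, Polynomial.aeval_X,
      algebraMap_eq_coe]
    push_cast
    linear_combination -X ^ 2 * h1 -
      (Polynomial.aeval factorialSeries) (Polynomial.derivative W) * derivative_factorialSeries
  have hVc (i : ℕ) : V.coeff i = Polynomial.X ^ 2 * Polynomial.derivative (W.coeff i) +
      (i : Polynomial ℂ) * (1 - Polynomial.X) * W.coeff i -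
        Polynomial.X * (((i : Polynomial ℂ) + 1) * W.coeff (i + 1)) := by
    rw [hV, hL, mul_sub, Polynomial.coeff_add, Polynomial.coeff_sub, Polynomial.coeff_C_mul,
      coeff_coeffDeriv, Polynomial.coeff_mul_C, Polynomial.coeff_derivative, mul_left_comm,
      Polynomial.coeff_C_mul]
    rcases i with _ | i
    · simp; ring
    · rw [Polynomial.coeff_mul_X, Polynomial.coeff_derivative]
      push_cast
      ring
  have hW2 : W.coeff (n + 2) = 0 := Polynomial.coeff_eq_zero_of_natDegree_lt (by omega)
  -- The terms of degree `n + 1` cancel, so minimality of `W` forces `U = 0`.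
  set U := Polynomial.C (W.coeff (n + 1)) * V - Polynomial.C (V.coeff (n + 1)) * W with hU
  have hUz : U = 0 := by
    refine hmin U ?_ ?_
    · rw [hU, map_sub, map_mul, map_mul, hVF, hWF]; simp
    · rw [hn]
      refine Nat.lt_succ_of_le (Polynomial.natDegree_le_iff_coeff_eq_zero.mpr fun N hN => ?_)
      rw [hU, Polynomial.coeff_sub, Polynomial.coeff_C_mul, Polynomial.coeff_C_mul]
      rcases Nat.lt_or_ge (n + 1) N with h | h
      · rw [hVc, Polynomial.coeff_eq_zero_of_natDegree_lt (p := W) (n := N) (by omega),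
          Polynomial.coeff_eq_zero_of_natDegree_lt (p := W) (n := N + 1) (by omega)]
        simp
      · obtain rfl : N = n + 1 := by omega
        ring
  have hUn := congrArg (fun P => P.coeff n) hUz
  simp only [hU, Polynomial.coeff_sub, Polynomial.coeff_C_mul, hVc, Polynomial.coeff_zero,
    hW2] at hUn
  have hq : W.coeff (n + 1) ≠ 0 := by
    rw [← hn]; exact Polynomial.leadingCoeff_ne_zero.mpr hW
  set p : ℂ⟦X⟧ := (W.coeff n : ℂ⟦X⟧) with hp
  set q : ℂ⟦X⟧ := (W.coeff (n + 1) : ℂ⟦X⟧) with hqdef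
  -- The coefficient of degree `n` in `U = 0` says that `-p/((n + 1)q)` satisfies the same linear
  -- equation as `F`. The difference of the two solves the homogeneous equation, so it vanishes and
  -- `F` would be rational.
  have h5 : X ^ 2 * (PowerSeries.derivative ℂ p * q - p * PowerSeries.derivative ℂ q) =
      (1 - X) * p * q + ((n : ℂ⟦X⟧) + 1) * X * q ^ 2 := by
    rw [hp, hqdef, derivative_coe, derivative_coe]
    have := congrArg (fun P : Polynomial ℂ => (P : ℂ⟦X⟧)) hUn
    simp only [Polynomial.coe_sub, Polynomial.coe_mul, Polynomial.coe_add, Polynomial.coe_pow,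
      Polynomial.coe_X, Polynomial.coe_one, Polynomial.coe_zero] at this
    push_cast at this
    rw [coe_natCast] at this
    linear_combination this
  have h6 : p + ((n : ℂ⟦X⟧) + 1) * q * factorialSeries = 0 := by
    refine eq_zero_of_homogeneous (q := q) (coe_ne_zero hq) ?_
    have hnd : PowerSeries.derivative ℂ ((n : ℂ⟦X⟧) + 1) = 0 := by
      rw [← Nat.cast_succ]; exact Derivation.map_natCast _ _
    rw [map_add, Derivation.leibniz, Derivation.leibniz, hnd]
    simp only [smul_eq_mul]
    linear_combination h5 + ((n : ℂ⟦X⟧) + 1) * q ^ 2 * derivative_factorialSeries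
  refine coe_mul_factorialSeries_ne (-W.coeff n) ((n + 1 : ℕ) * W.coeff (n + 1)) ?_ ?_
  · exact mul_ne_zero (by exact_mod_cast Nat.succ_ne_zero n) hq
  · push_cast
    rw [coe_natCast]
    linear_combination h6

/-! ### Differential equations of the form `V(f) f' = P(f)` -/

/-- A power series that represents a rational function. -/
def IsRatSeries (f : ℂ⟦X⟧) : Prop :=
  ∃ u p : Polynomial ℂ, u ≠ 0 ∧ (u : ℂ⟦X⟧) * f = p

theorem IsRatSeries.coe (p : Polynomial ℂ) : IsRatSeries p :=
  ⟨1, p, one_ne_zero, by simp⟩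

theorem IsRatSeries.add {f g : ℂ⟦X⟧} (hf : IsRatSeries f) (hg : IsRatSeries g) :
    IsRatSeries (f + g) := by
  obtain ⟨u, p, hu, hp⟩ := hf
  obtain ⟨v, q, hv, hq⟩ := hg
  refine ⟨u * v, v * p + u * q, mul_ne_zero hu hv, ?_⟩
  push_cast
  linear_combination (v : ℂ⟦X⟧) * hp + (u : ℂ⟦X⟧) * hq

theorem IsRatSeries.coe_mul {f : ℂ⟦X⟧} (hf : IsRatSeries f) (q : Polynomial ℂ) :
    IsRatSeries ((q : ℂ⟦X⟧) * f) := by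
  obtain ⟨u, p, hu, hp⟩ := hf
  refine ⟨u, q * p, hu, ?_⟩
  push_cast
  linear_combination (q : ℂ⟦X⟧) * hp

theorem IsRatSeries.sub {f g : ℂ⟦X⟧} (hf : IsRatSeries f) (hg : IsRatSeries g) :
    IsRatSeries (f - g) := by
  have := hf.add (hg.coe_mul (-1))
  rwa [Polynomial.coe_neg, Polynomial.coe_one, neg_one_mul, ← sub_eq_add_neg] at this

theorem IsRatSeries.derivative {f : ℂ⟦X⟧} (hf : IsRatSeries f) :
    IsRatSeries (PowerSeries.derivative ℂ f) := by
  obtain ⟨u, p, hu, hp⟩ := hf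
  refine ⟨u ^ 2, u * Polynomial.derivative p - Polynomial.derivative u * p,
    pow_ne_zero 2 hu, ?_⟩
  have := congrArg (PowerSeries.derivative ℂ) hp
  rw [Derivation.leibniz, derivative_coe, derivative_coe, smul_eq_mul, smul_eq_mul] at this
  push_cast
  linear_combination (u : ℂ⟦X⟧) * this - (Polynomial.derivative u : Polynomial ℂ) * hp

theorem IsRatSeries.iterate_derivative {f : ℂ⟦X⟧} (hf : IsRatSeries f) (n : ℕ) :
    IsRatSeries ((PowerSeries.derivative ℂ)^[n] f) := by
  induction n with
  | zero => exact hf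
  | succ n ih => rw [Function.iterate_succ_apply']; exact ih.derivative

theorem IsRatSeries.sum {ι : Type*} (s : Finset ι) (f : ι → ℂ⟦X⟧)
    (hf : ∀ i ∈ s, IsRatSeries (f i)) : IsRatSeries (∑ i ∈ s, f i) := by
  classical
  induction s using Finset.induction_on with
  | empty => simpa using IsRatSeries.coe 0
  | insert a s ha ih =>
    rw [Finset.sum_insert ha]
    exact (hf a (by simp)).add (ih fun i hi => hf i (by simp [hi]))

/-- `f` solves a linear differential equation with polynomial coefficients and rational
right-hand side. -/
def IsDFiniteModRat (f : ℂ⟦X⟧) : Prop :=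
  ∃ (d : ℕ) (q : ℕ → Polynomial ℂ), q d ≠ 0 ∧
    IsRatSeries (∑ j ∈ Finset.range (d + 1), (q j : ℂ⟦X⟧) * (PowerSeries.derivative ℂ)^[j] f)

theorem IsDFinite.isDFiniteModRat {f : ℂ⟦X⟧} (hf : IsDFinite f) : IsDFiniteModRat f := by
  obtain ⟨d, q, hq, h⟩ := hf
  exact ⟨d, q, hq, by rw [h]; simpa using IsRatSeries.coe 0⟩

theorem IsDFiniteModRat.of_add {f g : ℂ⟦X⟧} (hf : IsDFiniteModRat f)
    (hfg : IsRatSeries (f + g)) : IsDFiniteModRat g := by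
  obtain ⟨d, q, hq, h⟩ := hf
  refine ⟨d, q, hq, ?_⟩
  have h2 : IsRatSeries (∑ j ∈ Finset.range (d + 1),
      (q j : ℂ⟦X⟧) * (PowerSeries.derivative ℂ)^[j] (f + g)) :=
    IsRatSeries.sum _ _ fun j _ => (hfg.iterate_derivative j).coe_mul (q j)
  convert h2.sub h using 1
  rw [← Finset.sum_sub_distrib]
  refine Finset.sum_congr rfl fun j _ => ?_
  rw [iterate_map_add]
  ring

/-- If `V(f) f' = P(f)` then `V(f)^(2k+1) f^(k+1) = derivNum V P k (f)`. -/
def derivNum (V P : Polynomial (Polynomial ℂ)) : ℕ → Polynomial (Polynomial ℂ)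
  | 0 => P
  | k + 1 =>
    V * (V * coeffDeriv (derivNum V P k) -
      ((2 * k + 1 : ℕ) : Polynomial (Polynomial ℂ)) * derivNum V P k * coeffDeriv V) +
    P * (V * Polynomial.derivative (derivNum V P k) -
      ((2 * k + 1 : ℕ) : Polynomial (Polynomial ℂ)) * derivNum V P k * Polynomial.derivative V)

/-- Each differentiation costs two factors `V(f)`: one from the quotient rule and one from `f' =
P(f)/V(f)`. Hence the exponent `2k + 1`. -/
theorem aeval_derivNum {V P : Polynomial (Polynomial ℂ)} {f : ℂ⟦X⟧}
    (hf : Polynomial.aeval f V * PowerSeries.derivative ℂ f = Polynomial.aeval f P) (k : ℕ) :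
    Polynomial.aeval f V ^ (2 * k + 1) * (PowerSeries.derivative ℂ)^[k + 1] f =
      Polynomial.aeval f (derivNum V P k) := by
  induction k with
  | zero => simpa [derivNum] using hf
  | succ k ih =>
    have h1 := congrArg (PowerSeries.derivative ℂ) ih
    rw [Derivation.leibniz, derivative_aeval, derivative_pow, derivative_aeval,
      ← Function.iterate_succ_apply' (PowerSeries.derivative ℂ), Nat.add_sub_cancel] at h1
    simp only [smul_eq_mul] at h1
    simp only [derivNum, map_add, map_mul, map_sub, map_natCast]
    rw [show 2 * (k + 1) + 1 = 2 * k + 1 + 2 by ring, pow_add]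
    set v := Polynomial.aeval f V
    set vx := Polynomial.aeval f (coeffDeriv V)
    set vy := Polynomial.aeval f (Polynomial.derivative V)
    set a := Polynomial.aeval f (derivNum V P k)
    have h2 : v ^ (2 * k + 1) = v ^ (2 * k) * v := pow_succ _ _
    rw [h2] at ih h1 ⊢
    linear_combination v ^ 2 * h1 - ((2 * k + 1 : ℕ) : ℂ⟦X⟧) * (v * vx + vy *
      Polynomial.aeval f P) * ih + (Polynomial.aeval f (Polynomial.derivative (derivNum V P k)) * v
       - ((2 * k + 1 : ℕ) : ℂ⟦X⟧) * v ^ (2 * k + 1) * (PowerSeries.derivative ℂ)^[k + 1] f * vy)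
       * hf

/-- The polynomial relation obtained from a linear differential equation of order `e + 1`
with right-hand side `t` for a solution of `V(f) f' = P(f)`. -/
def elimPoly (V P : Polynomial (Polynomial ℂ)) (e : ℕ) (q : ℕ → Polynomial ℂ)
    (t : Polynomial ℂ) : Polynomial (Polynomial ℂ) :=
  V ^ (2 * e + 1) * (Polynomial.C (q 0) * Polynomial.X - Polynomial.C t) +
    ∑ k ∈ Finset.range (e + 1), Polynomial.C (q (k + 1)) * derivNum V P k * V ^ (2 * (e - k))

theorem IsDFiniteModRat.isAlgebraic {V P : Polynomial (Polynomial ℂ)} {f : ℂ⟦X⟧}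
    (hf : Polynomial.aeval f V * PowerSeries.derivative ℂ f = Polynomial.aeval f P)
    (hne : ∀ (e : ℕ) (q : ℕ → Polynomial ℂ) (t : Polynomial ℂ), q (e + 1) ≠ 0 →
      elimPoly V P e q t ≠ 0)
    (h : IsDFiniteModRat f) : IsAlgebraic (Polynomial ℂ) f := by
  obtain ⟨d, q, hq, u, t, hu, ht⟩ := h
  rcases d with _ | e
  -- An equation of order zero already makes `f` rational, and `elimPoly` is not needed.
  · refine ⟨Polynomial.C (u * q 0) * Polynomial.X - Polynomial.C t, fun h0 => ?_, ?_⟩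
    · have := congrArg (fun Q => Q.coeff 1) h0
      simp [hu, hq, Polynomial.coeff_C] at this
    · simp only [map_sub, map_mul, Polynomial.aeval_C, Polynomial.aeval_X, algebraMap_eq_coe,
        ← ht]
      simp
      ring
  · refine ⟨elimPoly V P e (fun j => u * q j) t, hne e _ t (mul_ne_zero hu hq), ?_⟩
    rw [Finset.sum_range_succ'] at ht
    simp only [elimPoly, map_add, map_sub, map_mul, map_pow, map_sum, Polynomial.aeval_C,
      Polynomial.aeval_X, algebraMap_eq_coe, ← aeval_derivNum hf, ← ht]
    set v := Polynomial.aeval f V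
    have : ∀ k ∈ Finset.range (e + 1), (u : ℂ⟦X⟧) * (q (k + 1) : ℂ⟦X⟧) *
        (v ^ (2 * k + 1) * (PowerSeries.derivative ℂ)^[k + 1] f) * v ^ (2 * (e - k)) =
        v ^ (2 * e + 1) * (u * ((q (k + 1) : ℂ⟦X⟧) * (PowerSeries.derivative ℂ)^[k + 1] f)) := by
      intro k hk
      rw [Finset.mem_range] at hk
      rw [show 2 * e + 1 = (2 * k + 1) + 2 * (e - k) by omega, pow_add]
      ring
    rw [Finset.sum_congr rfl this, ← Finset.mul_sum, ← Finset.mul_sum]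
    simp only [Function.iterate_zero, id]
    ring

theorem natDegree_derivNum_le {V P : Polynomial (Polynomial ℂ)} (hV : V.natDegree = 0)
    (hP : P.natDegree ≤ 2) (k : ℕ) : (derivNum V P k).natDegree ≤ k + 2 := by
  have hV' : (coeffDeriv V).natDegree ≤ 0 := hV ▸ natDegree_coeffDeriv_le V
  have hVd : Polynomial.derivative V = 0 := Polynomial.derivative_eq_zero.mpr hV
  induction k with
  | zero => simpa [derivNum] using hP
  | succ k ih =>
    have hm {A B : Polynomial (Polynomial ℂ)} {a b : ℕ} (hA : A.natDegree ≤ a)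
        (hB : B.natDegree ≤ b) : (A * B).natDegree ≤ a + b :=
      Polynomial.natDegree_mul_le.trans (add_le_add hA hB)
    rw [derivNum, hVd, mul_zero, sub_zero]
    refine Polynomial.natDegree_add_le_of_degree_le ?_ ?_
    · refine (hm hV.le (b := k + 2) ((Polynomial.natDegree_sub_le_of_le (m := k + 2) (n := k + 2)
        ?_ ?_).trans (max_self _).le)).trans ?_
      · simpa using hm hV.le ((natDegree_coeffDeriv_le _).trans ih)
      · have := hm (hm (Polynomial.natDegree_natCast (R := Polynomial ℂ) (2 * k + 1)).le ih) hV'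
        simpa using this
      · simp
    · have h1 : (Polynomial.derivative (derivNum V P k)).natDegree ≤ k + 1 :=
        (Polynomial.natDegree_derivative_le _).trans (by omega)
      exact (hm hP (hm hV.le h1)).trans (by omega)

/-- With `V` free of `y`, only the summand `P · V · ∂N/∂y` reaches the top degree; it multiplies the
leading coefficient by `k + 2`, by `V` and by the leading coefficient of `P`. -/
theorem coeff_derivNum_ne_zero {V P : Polynomial (Polynomial ℂ)} (hV : V.natDegree = 0)
    (hV0 : V ≠ 0) (hP : P.natDegree = 2) (k : ℕ) : (derivNum V P k).coeff (k + 2) ≠ 0 := by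
  have hV' : (coeffDeriv V).natDegree = 0 := Nat.le_zero.mp (hV ▸ natDegree_coeffDeriv_le V)
  have hVd : Polynomial.derivative V = 0 := Polynomial.derivative_eq_zero.mpr hV
  have hP2 : P.coeff 2 ≠ 0 := by
    rw [← hP]; exact Polynomial.leadingCoeff_ne_zero.mpr fun h => by simp [h] at hP
  obtain ⟨v, rfl⟩ := Polynomial.natDegree_eq_zero.mp hV
  have hv : v ≠ 0 := fun h => hV0 (by simp [h])
  obtain ⟨w, hw⟩ := Polynomial.natDegree_eq_zero.mp hV'
  induction k with
  | zero => simpa [derivNum] using hP2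
  | succ k ih =>
    have hd := natDegree_derivNum_le hV hP.le k
    have hz : (derivNum (Polynomial.C v) P k).coeff (k + 1 + 2) = 0 :=
      Polynomial.coeff_eq_zero_of_natDegree_lt (by omega)
    rw [derivNum, hVd, mul_zero, sub_zero, ← hw, Polynomial.coeff_add, Polynomial.coeff_C_mul,
      Polynomial.coeff_sub, Polynomial.coeff_C_mul, Polynomial.coeff_mul_C, coeff_coeffDeriv,
      ← Polynomial.C_eq_natCast, Polynomial.coeff_C_mul, hz, mul_left_comm,
      Polynomial.coeff_C_mul, show k + 1 + 2 = 2 + (k + 1) by ring,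
      Polynomial.coeff_mul_add_eq_of_natDegree_le hP.le
        ((Polynomial.natDegree_derivative_le _).trans (by omega)), Polynomial.coeff_derivative]
    simp only [map_zero, mul_zero, zero_mul, sub_zero, zero_add]
    refine mul_ne_zero hv (mul_ne_zero hP2 (mul_ne_zero ih ?_))
    exact_mod_cast Nat.succ_ne_zero (k + 1)

theorem elimPoly_ne_zero_of_natDegree {V P : Polynomial (Polynomial ℂ)} (hV : V.natDegree = 0)
    (hV0 : V ≠ 0) (hP : P.natDegree = 2) (e : ℕ) (q : ℕ → Polynomial ℂ) (t : Polynomial ℂ)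
    (hq : q (e + 1) ≠ 0) : elimPoly V P e q t ≠ 0 := by
  intro h0
  have h1 := congrArg (fun Q => Q.coeff (e + 2)) h0
  have hVk (k : ℕ) : (V ^ k).natDegree ≤ 0 := by simp [Polynomial.natDegree_pow, hV]
  simp only [elimPoly, Finset.sum_range_succ, Polynomial.coeff_add, Polynomial.coeff_zero,
    Polynomial.finsetSum_coeff] at h1
  rw [Polynomial.coeff_eq_zero_of_natDegree_lt, Finset.sum_eq_zero] at h1
  · rw [Nat.sub_self, mul_zero, pow_zero, mul_one, Polynomial.coeff_C_mul, zero_add,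
      zero_add] at h1
    exact mul_ne_zero hq (coeff_derivNum_ne_zero hV hV0 hP e) h1
  · intro k hk
    rw [Finset.mem_range] at hk
    refine Polynomial.coeff_eq_zero_of_natDegree_lt
      ((Polynomial.natDegree_mul_le.trans (add_le_add (b := k + 2) ?_ (hVk _))).trans_lt
        (by omega))
    exact (Polynomial.natDegree_C_mul_le _ _).trans (natDegree_derivNum_le hV hP.le k)
  · refine (Polynomial.natDegree_mul_le.trans (add_le_add (d := 1) (hVk _) ?_)).trans_lt
      (by omega)
    refine Polynomial.natDegree_sub_le_of_le (m := 1) (n := 1)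
      ((Polynomial.natDegree_C_mul_le _ _).trans ?_) ?_
    · simp
    · simp

/-- At a simple root `y` of `V` the recursion collapses to `N_{k+1}(y) = -(2k + 1) P(y) N_k(y)
V_y(y)`, which never vanishes. In `elimPoly` every term except the one with `k = e` keeps a factor
`V`, so its value at `y` is nonzero. -/
theorem elimPoly_ne_zero_of_root {V P : Polynomial (Polynomial ℂ)} {y : ℂ⟦X⟧}
    (hV : Polynomial.aeval y V = 0) (hV' : Polynomial.aeval y (Polynomial.derivative V) ≠ 0)
    (hP : Polynomial.aeval y P ≠ 0) (e : ℕ) (q : ℕ → Polynomial ℂ) (t : Polynomial ℂ)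
    (hq : q (e + 1) ≠ 0) : elimPoly V P e q t ≠ 0 := by
  have hN (k : ℕ) : Polynomial.aeval y (derivNum V P k) ≠ 0 := by
    induction k with
    | zero => exact hP
    | succ k ih =>
      simp only [derivNum, map_add, map_mul, hV, zero_mul, zero_add, map_sub, zero_sub,
        map_natCast]
      refine mul_ne_zero hP (neg_ne_zero.mpr (mul_ne_zero (mul_ne_zero ?_ ih) hV'))
      rw [← coe_natCast]
      exact coe_ne_zero (Nat.cast_ne_zero.mpr (Nat.succ_ne_zero (2 * k)))
  intro h0
  have h1 := congrArg (Polynomial.aeval y) h0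
  simp only [elimPoly, Finset.sum_range_succ, map_add, map_sum, map_mul, map_pow, map_zero,
    hV] at h1
  rw [Finset.sum_eq_zero] at h1
  · simp [algebraMap_eq_coe, hq, hN] at h1
  · intro k hk
    rw [Finset.mem_range] at hk
    rw [zero_pow (by omega), mul_zero]

/-! ### Non-D-finiteness of the inverse series; P-recursive sequences -/

theorem hasSubst_factorialSeries : HasSubst factorialSeries :=
  HasSubst.of_constantCoeff_zero' constantCoeff_factorialSeries

theorem hasSubst_comtetSeries : HasSubst comtetSeries :=
  HasSubst.substInvOfIsUnit _ _

theorem constantCoeff_comtetSeries : constantCoeff comtetSeries = 0 :=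
  constantCoeff_substInvOfIsUnit _ _

theorem subst_comtetSeries_factorialSeries : factorialSeries.subst comtetSeries = (X : ℂ⟦X⟧) :=
  subst_substInvOfIsUnit_right _ constantCoeff_factorialSeries _

theorem subst_factorialSeries_comtetSeries : comtetSeries.subst factorialSeries = (X : ℂ⟦X⟧) :=
  subst_substInvOfIsUnit_left _ constantCoeff_factorialSeries _

/-- Substitute `C` into the differential equation of `F` and use `F(C) = X` together with its
derivative `F'(C) C' = 1`. -/
theorem derivative_comtetSeries :
    (X - (1 + X) * comtetSeries) * PowerSeries.derivative ℂ comtetSeries = comtetSeries ^ 2 := by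
  have hs := hasSubst_comtetSeries
  have h1 := congrArg (PowerSeries.derivative ℂ) subst_comtetSeries_factorialSeries
  rw [derivative_subst hs, derivative_X] at h1
  have h2 := congrArg (PowerSeries.subst comtetSeries) derivative_factorialSeries
  rw [sub_mul, one_mul, subst_mul hs, subst_sub hs, subst_sub hs, subst_mul hs, subst_pow hs,
    subst_X hs, subst_comtetSeries_factorialSeries] at h2
  linear_combination comtetSeries ^ 2 * h1 - PowerSeries.derivative ℂ comtetSeries * h2

theorem subst_aeval {f g : ℂ⟦X⟧} (hg : HasSubst g) (hfg : f.subst g = (X : ℂ⟦X⟧))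
    (W : Polynomial (Polynomial ℂ)) :
    (Polynomial.aeval f W).subst g = Polynomial.aeval g (Polynomial.Bivariate.swap W) := by
  induction W using Polynomial.induction_on' with
  | add p q hp hq => rw [map_add, map_add, map_add, subst_add hg, hp, hq]
  | monomial n a =>
    induction a using Polynomial.induction_on' with
    | add p q hp hq =>
      rw [map_add, map_add, map_add, map_add, subst_add hg, hp, hq]
    | monomial m r =>
      have hc (r : ℂ) (k : ℕ) : ((Polynomial.monomial k r : Polynomial ℂ) : ℂ⟦X⟧) =
          C r * X ^ k := by
        rw [← Polynomial.C_mul_X_pow_eq_monomial]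
        simp
      have hC : (C r).subst g = C r := subst_C r
      rw [Polynomial.Bivariate.swap_monomial_monomial, Polynomial.aeval_monomial,
        Polynomial.aeval_monomial, algebraMap_eq_coe, algebraMap_eq_coe, subst_mul hg,
        subst_pow hg, hfg, hc, hc, subst_mul hg, subst_pow hg, subst_X hg, hC]
      ring

/-- Substituting `F` into `W(x, C(x)) = 0` gives `W(F(x), x) = 0`: exchanging the variables turns a
relation for `C` into one for `F`. -/
theorem comtetSeries_not_isAlgebraic : ¬ IsAlgebraic (Polynomial ℂ) comtetSeries := by
  rintro ⟨W, hW, h⟩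
  refine factorialSeries_not_isAlgebraic ⟨Polynomial.Bivariate.swap W, by simpa using hW, ?_⟩
  rw [← subst_aeval hasSubst_factorialSeries subst_factorialSeries_comtetSeries, h,
    ← coe_substAlgHom hasSubst_factorialSeries, map_zero]

theorem comtetSeries_not_isDFiniteModRat : ¬ IsDFiniteModRat comtetSeries := by
  intro h
  have hy : (1 + X : ℂ⟦X⟧) * (X * (1 + X)⁻¹) = X := by
    rw [mul_left_comm, PowerSeries.mul_inv_cancel _ (by simp), mul_one]
  have h1 : (1 + X : ℂ⟦X⟧) ≠ 0 := fun h0 => by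
    have := congrArg constantCoeff h0
    simp at this
  refine comtetSeries_not_isAlgebraic (h.isAlgebraic
    (V := Polynomial.C Polynomial.X - Polynomial.C (1 + Polynomial.X) * Polynomial.X)
    (P := Polynomial.X ^ 2) ?_ (elimPoly_ne_zero_of_root (y := X * (1 + X)⁻¹) ?_ ?_ ?_))
  · simpa [algebraMap_eq_coe] using derivative_comtetSeries
  · simpa [algebraMap_eq_coe, sub_eq_zero] using hy.symm
  · have : Polynomial.derivative (Polynomial.C Polynomial.X - Polynomial.C (1 + Polynomial.X) *
        Polynomial.X : Polynomial (Polynomial ℂ)) = 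
        -Polynomial.C (1 + Polynomial.X : Polynomial ℂ) := by
      simp
    rw [this, map_neg, Polynomial.aeval_C, algebraMap_eq_coe, neg_ne_zero]
    simpa using h1
  · rw [map_pow, Polynomial.aeval_X]
    refine pow_ne_zero 2 fun h0 => X_ne_zero (R := ℂ) ?_
    rw [← hy, h0, mul_zero]

theorem not_isDFiniteModRat_of_mul_one_add {f : ℂ⟦X⟧}
    (hf : f * (1 + factorialSeries) = factorialSeries) : ¬ IsDFiniteModRat f := by
  intro h
  have h1 : (1 + factorialSeries : ℂ⟦X⟧) ≠ 0 := fun h0 => by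
    have := congrArg constantCoeff h0
    simp [constantCoeff_factorialSeries] at this
  have hf2 : (1 - f) * factorialSeries = f := by linear_combination -hf
  -- The Riccati equation arises from the linear one for `F` through the Möbius substitution `F =
  -- f/(1 - f)`.
  have hd : X ^ 2 * PowerSeries.derivative ℂ f = -f ^ 2 + (1 + X) * f - X := by
    have h2 := congrArg (PowerSeries.derivative ℂ) hf
    rw [Derivation.leibniz, map_add, Derivation.map_one_eq_zero, zero_add] at h2
    simp only [smul_eq_mul] at h2
    refine mul_left_cancel₀ h1 ?_
    linear_combination X ^ 2 * h2 + (1 - f) * derivative_factorialSeries - (1 - f) * hf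
  have halg : IsAlgebraic (Polynomial ℂ) f := by
    refine h.isAlgebraic (V := Polynomial.C (Polynomial.X ^ 2))
      (P := Polynomial.C (-1) * Polynomial.X ^ 2 + Polynomial.C (1 + Polynomial.X) * Polynomial.X
        + Polynomial.C (-Polynomial.X)) ?_
      (elimPoly_ne_zero_of_natDegree ?_ ?_ ?_)
    · simp only [map_add, map_mul, map_pow, Polynomial.aeval_C, Polynomial.aeval_X,
        algebraMap_eq_coe, Polynomial.coe_X, Polynomial.coe_neg, Polynomial.coe_one]
      linear_combination hd
    · exact Polynomial.natDegree_C _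
    · simp
    · exact Polynomial.natDegree_quadratic (neg_ne_zero.mpr one_ne_zero)
  have h1f : (1 - f) ≠ 0 := fun h0 => by
    rw [← sub_eq_zero.mp h0, one_mul] at hf
    exact one_ne_zero (add_eq_right.mp hf)
  refine factorialSeries_not_isAlgebraic
    ((isAlgebraic_one.sub halg).of_mul (mem_nonZeroDivisors_of_ne_zero h1f) ?_)
  rwa [hf2]

/-! ### P-recursive sequences have D-finite generating functions -/

/-- Multiplication of the `n`-th coefficient by `p(n)`. -/
def evalMul (p : Polynomial ℂ) (f : ℂ⟦X⟧) : ℂ⟦X⟧ :=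
  PowerSeries.mk fun n => p.eval (n : ℂ) * coeff n f

/-- `L` is a linear differential operator with polynomial coefficients. -/
def IsDiffOp (L : ℂ⟦X⟧ → ℂ⟦X⟧) : Prop :=
  ∃ (d : ℕ) (q : ℕ → Polynomial ℂ), ∀ f,
    L f = ∑ j ∈ Finset.range d, (q j : ℂ⟦X⟧) * (PowerSeries.derivative ℂ)^[j] f

theorem IsDiffOp.add {L M : ℂ⟦X⟧ → ℂ⟦X⟧} (hL : IsDiffOp L) (hM : IsDiffOp M) :
    IsDiffOp fun f => L f + M f := by
  obtain ⟨d, q, hq⟩ := hL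
  obtain ⟨e, r, hr⟩ := hM
  refine ⟨d + e, fun j => (if j < d then q j else 0) + (if j < e then r j else 0), fun f => ?_⟩
  simp only [Polynomial.coe_add, add_mul, Finset.sum_add_distrib, hq, hr]
  congr 1
  · rw [← Finset.sum_subset (Finset.range_mono (Nat.le_add_right d e))]
    · exact Finset.sum_congr rfl fun j hj => by rw [if_pos (Finset.mem_range.mp hj)]
    · intro j _ hj
      rw [Finset.mem_range] at hj
      simp [hj]
  · rw [← Finset.sum_subset (Finset.range_mono (Nat.le_add_left e d))]
    · exact Finset.sum_congr rfl fun j hj => by rw [if_pos (Finset.mem_range.mp hj)]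
    · intro j _ hj
      rw [Finset.mem_range] at hj
      simp [hj]

theorem IsDiffOp.coe_mul {L : ℂ⟦X⟧ → ℂ⟦X⟧} (hL : IsDiffOp L) (p : Polynomial ℂ) :
    IsDiffOp fun f => (p : ℂ⟦X⟧) * L f := by
  obtain ⟨d, q, hq⟩ := hL
  refine ⟨d, fun j => p * q j, fun f => ?_⟩
  beta_reduce
  rw [hq, Finset.mul_sum]
  exact Finset.sum_congr rfl fun j _ => by push_cast; ring

theorem IsDiffOp.derivative {L : ℂ⟦X⟧ → ℂ⟦X⟧} (hL : IsDiffOp L) :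
    IsDiffOp fun f => PowerSeries.derivative ℂ (L f) := by
  obtain ⟨d, q, hq⟩ := hL
  have h1 : IsDiffOp fun f => ∑ j ∈ Finset.range d,
      (Polynomial.derivative (q j) : ℂ⟦X⟧) * (PowerSeries.derivative ℂ)^[j] f :=
    ⟨d, fun j => Polynomial.derivative (q j), fun f => rfl⟩
  have h2 : IsDiffOp fun f => ∑ j ∈ Finset.range d,
      (q j : ℂ⟦X⟧) * (PowerSeries.derivative ℂ)^[j + 1] f := by
    refine ⟨d + 1, fun j => if j = 0 then 0 else q (j - 1), fun f => ?_⟩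
    rw [Finset.sum_range_succ']
    simp
  convert h1.add h2 using 2 with f
  rw [hq, map_sum, ← Finset.sum_add_distrib]
  refine Finset.sum_congr rfl fun j _ => ?_
  rw [Derivation.leibniz, derivative_coe, Function.iterate_succ_apply', smul_eq_mul, smul_eq_mul]
  ring

theorem isDiffOp_sum {ι : Type*} (s : Finset ι) (L : ι → ℂ⟦X⟧ → ℂ⟦X⟧)
    (hL : ∀ i ∈ s, IsDiffOp (L i)) : IsDiffOp fun f => ∑ i ∈ s, L i f := by
  classical
  induction s using Finset.induction_on with
  | empty => exact ⟨0, 0, fun f => by simp⟩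
  | insert a s ha ih =>
    simp only [Finset.sum_insert ha]
    exact (hL a (by simp)).add (ih fun i hi => hL i (by simp [hi]))

/-- The operator `x d/dx` multiplies the `n`-th coefficient by `n`. -/
theorem isDiffOp_evalMul (p : Polynomial ℂ) : IsDiffOp (evalMul p) := by
  induction p using Polynomial.induction_on with
  | C a =>
    refine ⟨1, fun _ => Polynomial.C a, fun f => ?_⟩
    ext n
    simp [evalMul]
  | add p q hp hq =>
    convert hp.add hq using 2 with f
    ext n
    simp [evalMul, add_mul]
  | monomial n a h =>
    convert h.derivative.coe_mul Polynomial.X using 2 with f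
    ext k
    rw [Polynomial.coe_X]
    rcases k with _ | k
    · simp [evalMul]
    · rw [coeff_succ_X_mul, coeff_derivative]
      simp only [evalMul, coeff_mk, pow_succ, ← mul_assoc, Polynomial.eval_mul_X]
      push_cast
      ring

theorem IsDiffOp.isDFinite {L : ℂ⟦X⟧ → ℂ⟦X⟧} (hL : IsDiffOp L) (hne : ∃ g, L g ≠ 0)
    {f : ℂ⟦X⟧} (hf : L f = 0) : IsDFinite f := by
  classical
  obtain ⟨d, q, hq⟩ := hL
  obtain ⟨g, hg⟩ := hne
  have hex : ((Finset.range d).filter fun j => q j ≠ 0).Nonempty := by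
    by_contra hemp
    rw [Finset.not_nonempty_iff_eq_empty, Finset.filter_eq_empty_iff] at hemp
    refine hg ?_
    rw [hq]
    refine Finset.sum_eq_zero fun j hj => ?_
    have := hemp hj
    push Not at this
    simp [this]
  set e := ((Finset.range d).filter fun j => q j ≠ 0).max' hex with he
  have hmem := Finset.max'_mem _ hex
  rw [← he, Finset.mem_filter, Finset.mem_range] at hmem
  refine ⟨e, q, hmem.2, ?_⟩
  rw [← hf, hq]
  refine Finset.sum_subset (Finset.range_mono hmem.1) fun j hj hje => ?_
  have : q j = 0 := by
    by_contra h0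
    have := Finset.le_max' ((Finset.range d).filter fun j => q j ≠ 0) j (by simpa [h0] using hj)
    rw [Finset.mem_range] at hje
    omega
  simp [this]

theorem IsPRecursive.isDFinite {a : ℕ → ℂ} (ha : IsPRecursive a) : IsDFinite (genFun a) := by
  obtain ⟨d, p, hp, h⟩ := ha
  -- The recurrence is known only for `n ≥ 1`. The factor `r` vanishes at `0, -1, …, -d`, which
  -- kills the coefficients of index `N = n + d ≤ d`. The shift by `j` in `P j` compensates for the
  -- later multiplication by `X ^ (d - j)`.
  set r : Polynomial ℂ := ∏ i ∈ Finset.range (d + 1), (Polynomial.X + Polynomial.C (i : ℂ)) with hr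
  have hr0 : r ≠ 0 := Finset.prod_ne_zero_iff.mpr fun i _ => Polynomial.X_add_C_ne_zero _
  set P : ℕ → Polynomial ℂ := fun j => (r * p j).comp (Polynomial.X - Polynomial.C (j : ℂ))
    with hP
  have hPe (j : ℕ) (x : ℂ) : (P j).eval x = r.eval (x - j) * (p j).eval (x - j) := by
    simp [hP]
  set L : ℂ⟦X⟧ → ℂ⟦X⟧ := fun f => ∑ j ∈ Finset.range (d + 1),
    ((Polynomial.X ^ (d - j) : Polynomial ℂ) : ℂ⟦X⟧) * evalMul (P j) f with hL
  have hLc (f : ℂ⟦X⟧) (N : ℕ) : coeff N (L f) = ∑ j ∈ Finset.range (d + 1),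
      if d - j ≤ N then r.eval ((N : ℂ) - d) * (p j).eval ((N : ℂ) - d) *
        coeff (N - (d - j)) f else 0 := by
    simp only [hL, map_sum, Polynomial.coe_pow, Polynomial.coe_X, coeff_X_pow_mul']
    refine Finset.sum_congr rfl fun j hj => ?_
    rw [Finset.mem_range] at hj
    split_ifs with h1
    · simp only [evalMul, coeff_mk, hPe]
      rw [show (((N - (d - j) : ℕ) : ℂ) - j) = N - d by
        rw [Nat.cast_sub h1, Nat.cast_sub (by omega)]; ring]
    · rfl
  have hLd : IsDiffOp L := isDiffOp_sum _ _ fun j _ => (isDiffOp_evalMul (P j)).coe_mul _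
  refine hLd.isDFinite ?_ ?_
  -- The operator is nonzero: the coefficient of `X^M` in `L(X^M)` is `(r p_d)(M - d)`, only `j = d`
  -- contributing, and a nonzero polynomial cannot vanish for all `M`.
  · by_contra! hz
    have hrp : r * p d ≠ 0 := mul_ne_zero hr0 hp
    refine hrp (Polynomial.eq_zero_of_infinite_isRoot _ ?_)
    refine (Set.infinite_range_of_injective
      (f := fun M : ℕ => (M : ℂ) - d) fun x y hxy => ?_).mono ?_
    · exact_mod_cast sub_left_injective hxy
    · rintro _ ⟨M, rfl⟩
      have := hLc (X ^ M) M
      rw [hz, map_zero, Finset.sum_range_succ, Finset.sum_eq_zero] at this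
      · simpa [Polynomial.IsRoot, or_comm] using this
      · intro j hj
        rw [Finset.mem_range] at hj
        split_ifs with h1
        · rw [coeff_X_pow, if_neg (by omega), mul_zero]
        · rfl
  · ext N
    rw [hLc, map_zero]
    rcases Nat.lt_or_ge d N with hN | hN
    · have := h (N - d) (by omega)
      rw [← mul_zero (r.eval ((N : ℂ) - d)), ← this, Finset.mul_sum]
      refine Finset.sum_congr rfl fun j hj => ?_
      rw [Finset.mem_range] at hj
      rw [if_pos (by omega), coeff_genFun_of_pos _ (by omega), Nat.cast_sub hN.le, mul_assoc,
        show N - (d - j) = N - d + j by omega]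
    · refine Finset.sum_eq_zero fun j _ => ?_
      have : r.eval ((N : ℂ) - d) = 0 := by
        rw [hr, Polynomial.eval_prod]
        refine Finset.prod_eq_zero (i := d - N) (Finset.mem_range.mpr (by omega)) ?_
        simp [Nat.cast_sub hN]
      simp [this]

/-! ### Plus indecomposable permutations -/

section Permutations

open Equiv

/-- `π` maps the first `k` positions to the first `k` values. -/
def IsStable {n : ℕ} (π : Perm (Fin n)) (k : ℕ) : Prop :=
  ∀ i : Fin n, (i : ℕ) < k → (π i : ℕ) < k

/-- `π` is of the form `(12)[α, β]`. -/
def IsSumDecomposable {n : ℕ} (π : Perm (Fin n)) : Prop :=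
  ∃ k, 0 < k ∧ k < n ∧ IsStable π k

theorem inflateOneTwo_castAdd {k m : ℕ} (α : Perm (Fin k)) (β : Perm (Fin m)) (i : Fin k) :
    inflateOneTwo α β (Fin.castAdd m i) = Fin.castAdd m (α i) := by
  simp [inflateOneTwo, Equiv.permCongr_apply]

theorem isStable_inflateOneTwo {k m : ℕ} (α : Perm (Fin k)) (β : Perm (Fin m)) {l : ℕ}
    (hl : l ≤ k) : IsStable (inflateOneTwo α β) l ↔ IsStable α l := by
  constructor
  · intro h i hi
    have := h (Fin.castAdd m i) (by simpa using hi)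
    rw [inflateOneTwo_castAdd] at this
    simpa using this
  · intro h i hi
    have := h ⟨i, by omega⟩ hi
    rw [show i = Fin.castAdd m ⟨i, by omega⟩ from rfl, inflateOneTwo_castAdd]
    simpa using this

theorem isStable_self {n : ℕ} (π : Perm (Fin n)) : IsStable π n := fun i _ => (π i).isLt

theorem exists_eq_inflateOneTwo {k m : ℕ} {π : Perm (Fin (k + m))} (h : IsStable π k) :
    ∃ (α : Perm (Fin k)) (β : Perm (Fin m)), inflateOneTwo α β = π := by
  have hmem := Equiv.Perm.mem_sumCongrHom_range_of_perm_mapsTo_inl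
    (σ := finSumFinEquiv.symm.permCongr π) (by
      rintro _ ⟨i, rfl⟩
      have := h (Fin.castAdd m i) (by simp)
      refine ⟨⟨_, this⟩, ?_⟩
      rw [Equiv.permCongr_apply, Equiv.eq_symm_apply]
      ext
      simp)
  obtain ⟨⟨α, β⟩, hαβ⟩ := hmem
  refine ⟨α, β, ?_⟩
  rw [Equiv.Perm.sumCongrHom_apply] at hαβ
  rw [inflateOneTwo, hαβ]
  ext i
  simp [Equiv.permCongr_apply]

theorem inflateOneTwo_injective {k m : ℕ} :
    Function.Injective fun p : Perm (Fin k) × Perm (Fin m) => inflateOneTwo p.1 p.2 := by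
  intro p q h
  exact Equiv.Perm.sumCongrHom_injective ((finSumFinEquiv.permCongr).injective h)

theorem isPlusIndecomposable_iff {n : ℕ} (π : Perm (Fin n)) :
    IsPlusIndecomposable π ↔ ¬ IsSumDecomposable π := by
  rw [IsPlusIndecomposable, not_iff_not]
  constructor
  · rintro ⟨k, m, hk, hm, rfl, α, β, rfl⟩
    exact ⟨k, hk, by omega, (isStable_inflateOneTwo α β le_rfl).mpr (isStable_self α)⟩
  · rintro ⟨k, hk, hkn, hs⟩
    obtain ⟨m, rfl⟩ := Nat.exists_eq_add_of_lt hkn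
    obtain ⟨α, β, hαβ⟩ := exists_eq_inflateOneTwo (m := m + 1) hs
    exact ⟨k, m + 1, hk, by omega, rfl, α, β, hαβ.symm⟩

theorem exists_isStable {n : ℕ} (hn : 0 < n) (π : Perm (Fin n)) : ∃ k, 0 < k ∧ IsStable π k :=
  ⟨n, hn, isStable_self π⟩

open Classical in
-- Cutting at the least positive stable `k` gives `(12)[α, β]`; minimality of `k` is exactly plus
-- indecomposability of `α`, and `β` is arbitrary.
theorem card_first_stable {k m : ℕ} (hk : 0 < k) :
    (Finset.univ.filter fun π : Perm (Fin (k + m)) =>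
      Nat.find (exists_isStable (by omega : 0 < k + m) π) = k).card =
      numPlusIndec k * m.factorial := by
  rw [← Fintype.card_subtype, ← Nat.card_eq_fintype_card, numPlusIndec]
  have : m.factorial = Nat.card (Perm (Fin m)) := by
    rw [Nat.card_eq_fintype_card, Fintype.card_perm, Fintype.card_fin]
  rw [this, ← Nat.card_prod]
  symm
  have hind (α : Perm (Fin k)) : IsPlusIndecomposable α ↔ ∀ l < k, ¬ (0 < l ∧ IsStable α l) := by
    rw [isPlusIndecomposable_iff, IsSumDecomposable]
    push Not
    exact ⟨fun h l hl h0 => h l h0 hl, fun h l h0 hl => h l hl h0⟩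
  refine Nat.card_congr (Equiv.ofBijective (fun p => ⟨inflateOneTwo p.1.1 p.2, ?_⟩) ⟨?_, ?_⟩)
  · rw [Nat.find_eq_iff]
    refine ⟨⟨hk, (isStable_inflateOneTwo _ _ le_rfl).mpr (isStable_self _)⟩, fun l hl => ?_⟩
    rw [isStable_inflateOneTwo _ _ hl.le]
    exact (hind _).mp p.1.2 l hl
  · rintro ⟨⟨α, hα⟩, β⟩ ⟨⟨α', hα'⟩, β'⟩ h
    have := inflateOneTwo_injective (a₁ := (α, β)) (a₂ := (α', β')) (Subtype.ext_iff.mp h)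
    simp only [Prod.mk.injEq] at this
    obtain ⟨rfl, rfl⟩ := this
    rfl
  · rintro ⟨π, hπ⟩
    rw [Nat.find_eq_iff] at hπ
    obtain ⟨α, β, rfl⟩ := exists_eq_inflateOneTwo hπ.1.2
    refine ⟨⟨⟨α, (hind α).mpr fun l hl => ?_⟩, β⟩, rfl⟩
    rw [← isStable_inflateOneTwo α β hl.le]
    exact hπ.2 l hl

theorem factorial_eq_sum_numPlusIndec {n : ℕ} (hn : 0 < n) :
    n.factorial = ∑ k ∈ Finset.Icc 1 n, numPlusIndec k * (n - k).factorial := by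
  classical
  have h1 : n.factorial = (Finset.univ : Finset (Perm (Fin n))).card := by
    rw [Finset.card_univ, Fintype.card_perm, Fintype.card_fin]
  rw [h1, Finset.card_eq_sum_card_fiberwise (t := Finset.Icc 1 n)
    (f := fun π => Nat.find (exists_isStable hn π))]
  · refine Finset.sum_congr rfl fun k hk => ?_
    rw [Finset.mem_Icc] at hk
    obtain ⟨m, rfl⟩ := Nat.exists_eq_add_of_le hk.2
    rw [Nat.add_sub_cancel_left, ← card_first_stable (m := m) (by omega)]
  · intro π _
    rw [Finset.mem_coe, Finset.mem_Icc]
    exact ⟨(Nat.find_spec (exists_isStable hn π)).1, Nat.find_min' _ ⟨hn, isStable_self π⟩⟩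

theorem genFun_numPlusIndec_mul :
    genFun (fun n => (numPlusIndec n : ℂ)) * (1 + factorialSeries) = factorialSeries := by
  have hF (n : ℕ) : coeff n (1 + factorialSeries) = (n.factorial : ℂ) := by
    rcases n with _ | n
    · simp [constantCoeff_factorialSeries]
    · rw [map_add, coeff_factorialSeries (by omega), coeff_one]
      simp
  ext n
  rcases Nat.eq_zero_or_pos n with rfl | hn
  · simp [genFun, constantCoeff_factorialSeries]
  · rw [coeff_factorialSeries hn.ne', factorial_eq_sum_numPlusIndec hn, coeff_mul,
      Finset.Nat.sum_antidiagonal_eq_sum_range_succ_mk, Finset.range_eq_Ico,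
      Finset.sum_eq_sum_Ico_succ_bot (by omega), coeff_zero_genFun, zero_mul, zero_add]
    push_cast
    refine Finset.sum_congr rfl fun k hk => ?_
    have hk : 1 ≤ k := (Finset.mem_Icc.mp hk).1
    rw [coeff_genFun_of_pos _ (by omega), hF]

/-! ### Quotients of permutations by intervals -/

theorem ordConnected_iff_exists_Icc {n : ℕ} {B : Set (Fin n)} (hB : B.Nonempty) :
    B.OrdConnected ↔ ∃ a b : Fin n, a ≤ b ∧ B = Set.Icc a b := by
  classical
  constructor
  · intro h
    have hfin : B.Finite := Set.toFinite B
    obtain ⟨a, haB, ha⟩ := Set.exists_min_image B id hfin hB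
    obtain ⟨b, hbB, hb⟩ := Set.exists_max_image B id hfin hB
    exact ⟨a, b, ha b hbB, Set.Subset.antisymm (fun x hx => ⟨ha x hx, hb x hx⟩)
      (h.out haB hbB)⟩
  · rintro ⟨a, b, -, rfl⟩
    exact Set.ordConnected_Icc

theorem isBlock_iff {n : ℕ} (π : Perm (Fin n)) (B : Set (Fin n)) :
    IsBlock π B ↔ B.Nonempty ∧ B.OrdConnected ∧ (π '' B).OrdConnected := by
  constructor
  · rintro ⟨⟨a, b, hab, rfl⟩, c, d, h⟩
    exact ⟨⟨a, le_rfl, hab⟩, Set.ordConnected_Icc, h ▸ Set.ordConnected_Icc⟩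
  · rintro ⟨hne, h1, h2⟩
    obtain ⟨c, d, -, h⟩ := (ordConnected_iff_exists_Icc (hne.image π)).mp h2
    exact ⟨(ordConnected_iff_exists_Icc hne).mp h1, c, d, h⟩

theorem ordConnected_image {n m : ℕ} {g : Fin n → Fin m} (hg : Monotone g)
    (hs : Function.Surjective g) {J : Set (Fin n)} (hJ : J.OrdConnected) :
    (g '' J).OrdConnected := by
  refine ⟨?_⟩
  rintro _ ⟨x, hx, rfl⟩ _ ⟨z, hz, rfl⟩ b ⟨hxb, hbz⟩
  obtain ⟨y, rfl⟩ := hs b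
  rcases le_total y x with h | h
  · exact ⟨x, hx, le_antisymm hxb (hg h)⟩
  rcases le_total z y with h' | h'
  · exact ⟨z, hz, le_antisymm (hg h') hbz⟩
  exact ⟨y, hJ.out hx hz ⟨h, h'⟩, rfl⟩

/-- `g` presents `π` as an inflation of `σ`: it sends each position to the index of the
interval containing it. -/
structure IsQuotient {n m : ℕ} (π : Perm (Fin n)) (g : Fin n → Fin m) (σ : Perm (Fin m)) :
    Prop where
  mono : Monotone g
  surj : Function.Surjective g
  mono' : Monotone (σ ∘ g ∘ π.symm)

theorem IsQuotient.surj' {n m : ℕ} {π : Perm (Fin n)} {g : Fin n → Fin m} {σ : Perm (Fin m)}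
    (h : IsQuotient π g σ) : Function.Surjective (σ ∘ g ∘ π.symm) :=
  σ.surjective.comp (h.surj.comp π.symm.surjective)

/-- Removing a point extreme in both position and value would leave a proper block with at least two
elements. -/
theorem IsSimple.not_extreme {m : ℕ} {σ : Perm (Fin m)} (hσ : IsSimple σ) (hm : 3 ≤ m)
    {a : Fin m} (ha : IsMin a ∨ IsMax a) : ¬ (IsMin (σ a) ∨ IsMax (σ a)) := by
  intro hb
  have key (x : Fin m) (hx : IsMin x ∨ IsMax x) : ({x}ᶜ : Set (Fin m)).OrdConnected := by
    refine ⟨fun y hy z hz w hw hwx => ?_⟩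
    rw [Set.mem_singleton_iff] at hwx
    subst hwx
    rcases hx with h | h
    · exact hy (h.eq_of_ge hw.1).symm
    · exact hz (h.eq_of_le hw.2).symm
  have hcard : 3 ≤ Fintype.card (Fin m) := by simpa using hm
  have hne : ({a}ᶜ : Set (Fin m)).Nontrivial := by
    rw [← Set.one_lt_ncard_iff_nontrivial]
    have := Set.ncard_add_ncard_compl ({a} : Set (Fin m))
    rw [Set.ncard_singleton, Nat.card_eq_fintype_card] at this
    omega
  have himg : (σ '' {a}ᶜ).OrdConnected := by
    rw [Set.image_compl_eq σ.bijective, Set.image_singleton]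
    exact key _ hb
  rcases hσ {a}ᶜ ((isBlock_iff _ _).mpr ⟨hne.nonempty, key a ha, himg⟩) with ⟨b, h⟩ | h
  · rw [h] at hne
    exact Set.not_nontrivial_singleton hne
  · have : a ∈ ({a}ᶜ : Set (Fin m)) := h ▸ Set.mem_univ a
    exact this rfl

/-- The quotient map onto a simple permutation is constant on every proper block. -/
theorem IsQuotient.eq_of_mem {n m : ℕ} {π : Perm (Fin n)} {g : Fin n → Fin m}
    {σ : Perm (Fin m)} (h : IsQuotient π g σ) (hσ : IsSimple σ) (hm : 3 ≤ m)
    {J : Set (Fin n)} (hJ : J.OrdConnected) (hJ' : (π '' J).OrdConnected) (hJu : J ≠ Set.univ)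
    {p q : Fin n} (hp : p ∈ J) (hq : q ∈ J) : g p = g q := by
  have himg : (σ ∘ g ∘ π.symm) '' (π '' J) = σ '' (g '' J) := by
    simp [Set.image_image]
  rcases hσ (g '' J) ((isBlock_iff _ _).mpr ⟨⟨g p, p, hp, rfl⟩, ordConnected_image h.mono h.surj hJ,
    himg ▸ ordConnected_image h.mono' h.surj' hJ'⟩) with ⟨a, ha⟩ | hu
  · have h1 : g p ∈ g '' J := ⟨p, hp, rfl⟩
    have h2 : g q ∈ g '' J := ⟨q, hq, rfl⟩
    rw [ha] at h1 h2
    exact h1.trans h2.symm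
  · refine absurd (Set.eq_univ_iff_forall.mpr fun x => ?_) hJu
    -- `J` meets every interval. If the interval of `x` is not extreme in position, `x` lies between
    -- two positions of `J`; otherwise it is not extreme in value, and `π x` lies between two values
    -- of `π '' J`. Either way convexity gives `x ∈ J`.
    by_cases hx : IsMin (g x) ∨ IsMax (g x)
    · have hy := hσ.not_extreme hm hx
      rw [not_or, not_isMin_iff, not_isMax_iff] at hy
      obtain ⟨⟨b, hb⟩, c, hc⟩ := hy
      have hu' : (σ ∘ g ∘ π.symm) '' (π '' J) = Set.univ := by
        rw [himg, hu, Set.image_univ, σ.surjective.range_eq]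
      obtain ⟨y, hyJ, rfl⟩ : b ∈ (σ ∘ g ∘ π.symm) '' (π '' J) := hu' ▸ Set.mem_univ b
      obtain ⟨z, hzJ, rfl⟩ : c ∈ (σ ∘ g ∘ π.symm) '' (π '' J) := hu' ▸ Set.mem_univ c
      have hx' : (σ ∘ g ∘ π.symm) (π x) = σ (g x) := by simp
      rw [← hx'] at hb hc
      have := hJ'.out hyJ hzJ ⟨(h.mono'.reflect_lt hb).le, (h.mono'.reflect_lt hc).le⟩
      rwa [π.injective.mem_set_image] at this
    · rw [not_or, not_isMin_iff, not_isMax_iff] at hx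
      obtain ⟨⟨b, hb⟩, c, hc⟩ := hx
      obtain ⟨y, hyJ, rfl⟩ : b ∈ g '' J := hu ▸ Set.mem_univ b
      obtain ⟨z, hzJ, rfl⟩ : c ∈ g '' J := hu ▸ Set.mem_univ c
      exact hJ.out hyJ hzJ ⟨(h.mono.reflect_lt hb).le, (h.mono.reflect_lt hc).le⟩

/-- Reversal of the values of a permutation. -/
def valueRev {n : ℕ} (π : Perm (Fin n)) : Perm (Fin n) := π.trans Fin.revPerm

theorem valueRev_apply {n : ℕ} (π : Perm (Fin n)) (i : Fin n) :
    valueRev π i = Fin.rev (π i) := rfl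

theorem IsStable.image_eq {n : ℕ} {π : Perm (Fin n)} {k : ℕ} (h : IsStable π k) :
    π '' {i : Fin n | (i : ℕ) < k} = {i : Fin n | (i : ℕ) < k} := by
  refine Set.eq_of_subset_of_ncard_le ?_ ?_ (Set.toFinite _)
  · rintro _ ⟨i, hi, rfl⟩
    exact h i hi
  · rw [Set.ncard_image_of_injective _ π.injective]

theorem ordConnected_lt {n : ℕ} (k : ℕ) : {i : Fin n | (i : ℕ) < k}.OrdConnected :=
  ⟨fun _ _ _ hz _ hw => lt_of_le_of_lt (Fin.le_def.mp hw.2) hz⟩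

theorem ordConnected_lt_compl {n : ℕ} (k : ℕ) : {i : Fin n | (i : ℕ) < k}ᶜ.OrdConnected :=
  ⟨fun _ hy _ _ _ hw hw' => hy (lt_of_le_of_lt (Fin.le_def.mp hw.1) hw')⟩

/-- `J` and its complement would both be proper blocks, so `g` would take at most two values. This
excludes sum and skew decompositions alike. -/
theorem IsQuotient.not_split {n m : ℕ} {π : Perm (Fin n)} {g : Fin n → Fin m}
    {σ : Perm (Fin m)} (h : IsQuotient π g σ) (hσ : IsSimple σ) (hm : 3 ≤ m)
    {J : Set (Fin n)} (h1 : J.OrdConnected) (h2 : Jᶜ.OrdConnected) (h3 : (π '' J).OrdConnected)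
    (h4 : (π '' J)ᶜ.OrdConnected) (h5 : J ≠ Set.univ) (h6 : J.Nonempty) : False := by
  have h7 : Jᶜ.Nonempty := Set.nonempty_compl.mpr h5
  have h8 : Jᶜ ≠ Set.univ := fun h0 => by
    rw [Set.compl_univ_iff] at h0
    exact h6.ne_empty h0
  rw [← Set.image_compl_eq π.bijective] at h4
  obtain ⟨p, hp⟩ := h6
  obtain ⟨q, hq⟩ := h7
  have hr (x : Fin m) : x = g p ∨ x = g q := by
    obtain ⟨y, rfl⟩ := h.surj x
    by_cases hy : y ∈ J
    · exact Or.inl (h.eq_of_mem hσ hm h1 h3 h5 hy hp)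
    · exact Or.inr (h.eq_of_mem hσ hm h2 h4 h8 hy hq)
  have hcard : (Finset.univ : Finset (Fin m)).card ≤ ({g p, g q} : Finset (Fin m)).card :=
    Finset.card_le_card fun x _ => by simpa using hr x
  rw [Finset.card_univ, Fintype.card_fin] at hcard
  have := hcard.trans Finset.card_le_two
  omega

theorem IsQuotient.not_isSumDecomposable {n m : ℕ} {π : Perm (Fin n)} {g : Fin n → Fin m}
    {σ : Perm (Fin m)} (h : IsQuotient π g σ) (hσ : IsSimple σ) (hm : 3 ≤ m) :
    ¬ IsSumDecomposable π := by
  rintro ⟨k, hk, hkn, hs⟩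
  refine h.not_split hσ hm (ordConnected_lt k) (ordConnected_lt_compl k) ?_ ?_ ?_ ?_
  · rw [hs.image_eq]; exact ordConnected_lt k
  · rw [hs.image_eq]; exact ordConnected_lt_compl k
  · intro h0
    have : (⟨k, hkn⟩ : Fin n) ∈ {i : Fin n | (i : ℕ) < k} := h0 ▸ Set.mem_univ _
    exact lt_irrefl k (Set.mem_ofPred.mp this)
  · exact ⟨⟨0, by omega⟩, hk⟩

theorem IsQuotient.not_isSumDecomposable_valueRev {n m : ℕ} {π : Perm (Fin n)}
    {g : Fin n → Fin m} {σ : Perm (Fin m)} (h : IsQuotient π g σ) (hσ : IsSimple σ)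
    (hm : 3 ≤ m) : ¬ IsSumDecomposable (valueRev π) := by
  rintro ⟨k, hk, hkn, hs⟩
  have himg : π '' {i : Fin n | (i : ℕ) < k} = Fin.rev ⁻¹' {i : Fin n | (i : ℕ) < k} := by
    conv_rhs => rw [← hs.image_eq]
    ext x
    constructor
    · rintro ⟨i, hi, rfl⟩
      exact ⟨i, hi, rfl⟩
    · rintro ⟨i, hi, hix⟩
      exact ⟨i, hi, Fin.rev_injective hix⟩
  refine h.not_split hσ hm (ordConnected_lt k) (ordConnected_lt_compl k) ?_ ?_ ?_ ?_
  · rw [himg]; exact (ordConnected_lt k).preimage_anti Fin.rev_anti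
  · rw [himg, ← Set.preimage_compl]; exact (ordConnected_lt_compl k).preimage_anti Fin.rev_anti
  · intro h0
    have : (⟨k, hkn⟩ : Fin n) ∈ {i : Fin n | (i : ℕ) < k} := h0 ▸ Set.mem_univ _
    exact lt_irrefl k (Set.mem_ofPred.mp this)
  · exact ⟨⟨0, by omega⟩, hk⟩

theorem not_isSumDecomposable_and_valueRev {n : ℕ} (π : Perm (Fin n))
    (h : IsSumDecomposable π) : ¬ IsSumDecomposable (valueRev π) := by
  rintro ⟨l, hl, hln, hls⟩
  obtain ⟨k, hk, hkn, hks⟩ := h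
  rcases le_total k l with hkl | hkl
  · have : (⟨0, by omega⟩ : Fin n) ∈ π '' {i : Fin n | (i : ℕ) < k} := by
      rw [hks.image_eq]; exact hk
    obtain ⟨i, hi, hi0⟩ := this
    have := hls i (lt_of_lt_of_le hi hkl)
    rw [valueRev_apply, hi0, Fin.val_rev] at this
    simp only at this
    omega
  · have : (⟨0, by omega⟩ : Fin n) ∈ valueRev π '' {i : Fin n | (i : ℕ) < l} := by
      rw [hls.image_eq]; exact hl
    obtain ⟨i, hi, hi0⟩ := this
    have h1 := hks i (lt_of_lt_of_le hi hkl)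
    have h2 := congrArg Fin.val hi0
    rw [valueRev_apply, Fin.val_rev] at h2
    simp only at h2
    omega

/-- The induced bijection `Fin m → Fin m'` is strictly increasing, and the only order automorphism
of `Fin m` is the identity. -/
theorem eq_of_ker_eq {n m m' : ℕ} {g : Fin n → Fin m} {g' : Fin n → Fin m'} (hg : Monotone g)
    (hs : Function.Surjective g) (hg' : Monotone g') (hs' : Function.Surjective g')
    (hker : ∀ p q, g p = g q ↔ g' p = g' q) : m = m' ∧ ∀ p, (g p : ℕ) = g' p := by
  set e : Fin m → Fin m' := fun i => g' (Function.surjInv hs i) with he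
  have heg (p : Fin n) : e (g p) = g' p :=
    (hker _ _).mp (Function.surjInv_eq hs (g p))
  have hmono : StrictMono e := by
    intro a b hab
    obtain ⟨p, rfl⟩ := hs a
    obtain ⟨q, rfl⟩ := hs b
    rw [heg, heg]
    exact lt_of_le_of_ne (hg' (hg.reflect_lt hab).le) fun h => hab.ne ((hker _ _).mpr h)
  have hsurj : Function.Surjective e := fun b => by
    obtain ⟨p, rfl⟩ := hs' b
    exact ⟨g p, heg p⟩
  have hm : m = m' := by
    simpa using Fintype.card_of_bijective ⟨hmono.injective, hsurj⟩
  subst hm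
  refine ⟨rfl, fun p => ?_⟩
  have h1 : hmono.orderIsoOfSurjective e hsurj = OrderIso.refl _ := Subsingleton.elim _ _
  have h2 := DFunLike.congr_fun h1 (g p)
  rw [StrictMono.coe_orderIsoOfSurjective, heg] at h2
  rw [h2]
  rfl

theorem IsQuotient.ker_imp {n m m' : ℕ} {π : Perm (Fin n)} {g : Fin n → Fin m}
    {σ : Perm (Fin m)} {g' : Fin n → Fin m'} {σ' : Perm (Fin m')} (h : IsQuotient π g σ)
    (h' : IsQuotient π g' σ') (hσ : IsSimple σ) (hm : 3 ≤ m) (hm' : 2 ≤ m') {p q : Fin n}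
    (hpq : g' p = g' q) : g p = g q := by
  refine h.eq_of_mem hσ hm (J := g' ⁻¹' {g' q})
    (Set.ordConnected_singleton.preimage_mono h'.mono) ?_ ?_ hpq rfl
  · have : π '' (g' ⁻¹' {g' q}) = (σ' ∘ g' ∘ π.symm) ⁻¹' {σ' (g' q)} := by
      ext x
      rw [Equiv.image_eq_preimage_symm]
      simp
    rw [this]
    exact Set.ordConnected_singleton.preimage_mono h'.mono'
  · intro h0
    have : Nontrivial (Fin m') := Fin.nontrivial_iff_two_le.mpr hm'
    obtain ⟨b, hb⟩ := exists_ne (g' q)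
    obtain ⟨x, rfl⟩ := h'.surj b
    have : x ∈ g' ⁻¹' {g' q} := h0 ▸ Set.mem_univ x
    exact hb this

/-- The fibres of each quotient map are proper blocks of `π`, on which the other map is constant. So
the kernels agree, which fixes `g`; the same comparison along values fixes `σ`. -/
theorem IsQuotient.unique {n m m' : ℕ} {π : Perm (Fin n)} {g : Fin n → Fin m}
    {σ : Perm (Fin m)} {g' : Fin n → Fin m'} {σ' : Perm (Fin m')} (h : IsQuotient π g σ)
    (h' : IsQuotient π g' σ') (hσ : IsSimple σ) (hσ' : IsSimple σ') (hm : 3 ≤ m)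
    (hm' : 3 ≤ m') : ∃ e : m = m', g' = e ▸ g ∧ σ' = e ▸ σ := by
  have hker (p q : Fin n) : g p = g q ↔ g' p = g' q :=
    ⟨fun hpq => h'.ker_imp h hσ' hm' (by omega) hpq, fun hpq => h.ker_imp h' hσ hm (by omega) hpq⟩
  obtain ⟨rfl, hg⟩ := eq_of_ker_eq h.mono h.surj h'.mono h'.surj hker
  have hgg : g' = g := funext fun p => Fin.ext (hg p).symm
  subst hgg
  refine ⟨rfl, rfl, ?_⟩
  obtain ⟨-, hσσ⟩ := eq_of_ker_eq h.mono' h.surj' h'.mono' h'.surj' (by simp)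
  ext b
  obtain ⟨x, rfl⟩ := h.surj b
  simpa using (hσσ (π x)).symm

/-! ### Existence of simple quotients -/

/-- A monotone map to a linear order factors through its ranked range. -/
theorem exists_monotone_surjective {n : ℕ} {α : Type*} [LinearOrder α] {f : Fin n → α}
    (hf : Monotone f) : ∃ (m : ℕ) (u : Fin n → Fin m), Monotone u ∧ Function.Surjective u ∧
      ∀ x y, u x = u y ↔ f x = f y := by
  classical
  set s := Finset.univ.image f
  have hmem (x : Fin n) : f x ∈ s := Finset.mem_image_of_mem f (Finset.mem_univ x)
  refine ⟨s.card, fun x => (s.orderIsoOfFin rfl).symm ⟨f x, hmem x⟩, ?_, ?_, ?_⟩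
  · intro x y hxy
    exact (s.orderIsoOfFin rfl).symm.monotone (hf hxy)
  · intro b
    obtain ⟨x, -, hx⟩ := Finset.mem_image.mp (s.orderIsoOfFin rfl b).2
    refine ⟨x, ?_⟩
    rw [OrderIso.symm_apply_eq]
    exact Subtype.ext hx
  · intro x y
    simp

theorem exists_perm_of_ker {n m m' : ℕ} {u : Fin n → Fin m} {v : Fin n → Fin m'}
    (hu : Function.Surjective u) (hv : Function.Surjective v)
    (h : ∀ x y, u x = u y ↔ v x = v y) : ∃ e : Fin m ≃ Fin m', ∀ x, e (u x) = v x := by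
  have he (x : Fin n) : v (Function.surjInv hu (u x)) = v x :=
    (h _ _).mp (Function.surjInv_eq hu (u x))
  refine ⟨Equiv.ofBijective (fun i => v (Function.surjInv hu i)) ⟨?_, ?_⟩, he⟩
  · intro a b hab
    obtain ⟨x, rfl⟩ := hu a
    obtain ⟨y, rfl⟩ := hu b
    simp only [he] at hab
    exact (h x y).mpr hab
  · intro b
    obtain ⟨x, rfl⟩ := hv b
    exact ⟨u x, he x⟩

theorem monotone_collapse {m : ℕ} (a b : Fin m) :
    Monotone fun x : Fin m => if x ∈ Set.Icc a b then a else x := by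
  intro x y hxy
  simp only [Set.mem_Icc]
  split_ifs with h1 h2 h2
  · exact le_rfl
  · exact h1.1.trans hxy
  · by_contra hlt
    push Not at hlt
    exact h1 ⟨hlt.le, hxy.trans h2.2⟩
  · exact hxy

theorem collapse_eq_iff {m : ℕ} {a b : Fin m} (hab : a ≤ b) (x y : Fin m) :
    ((if x ∈ Set.Icc a b then a else x) = if y ∈ Set.Icc a b then a else y) ↔
      x = y ∨ (x ∈ Set.Icc a b ∧ y ∈ Set.Icc a b) := by
  have ha : a ∈ Set.Icc a b := ⟨le_rfl, hab⟩
  by_cases hx : x ∈ Set.Icc a b <;> by_cases hy : y ∈ Set.Icc a b <;> simp [hx, hy]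
  · exact ⟨fun h => absurd (h ▸ ha) hy, fun h => absurd (h ▸ hx) hy⟩
  · exact ⟨fun h => absurd (h ▸ ha) hx, fun h => absurd (h ▸ hy) hx⟩

theorem IsQuotient.trans {n m l : ℕ} {π : Perm (Fin n)} {g : Fin n → Fin m} {σ : Perm (Fin m)}
    {u : Fin m → Fin l} {τ : Perm (Fin l)} (h : IsQuotient π g σ) (h' : IsQuotient σ u τ) :
    IsQuotient π (u ∘ g) τ := by
  refine ⟨h'.mono.comp h.mono, h'.surj.comp h.surj, ?_⟩
  have : τ ∘ (u ∘ g) ∘ π.symm = (τ ∘ u ∘ σ.symm) ∘ (σ ∘ g ∘ π.symm) := by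
    ext x
    simp
  rw [this]
  exact h'.mono'.comp h.mono'

/-- A permutation with a nontrivial block has a shorter quotient. -/
theorem exists_isQuotient_of_not_isSimple {m : ℕ} {σ : Perm (Fin m)} (hσ : ¬ IsSimple σ) :
    ∃ (l : ℕ) (u : Fin m → Fin l) (τ : Perm (Fin l)), 2 ≤ l ∧ l < m ∧ IsQuotient σ u τ := by
  simp only [IsSimple, not_forall, not_or] at hσ
  obtain ⟨B, ⟨⟨a, b, hab, hB⟩, c, d, hcd⟩, hs, hu⟩ := hσ
  have ha : a ∈ Set.Icc a b := ⟨le_rfl, hab⟩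
  have hmem (x : Fin m) : σ x ∈ Set.Icc c d ↔ x ∈ Set.Icc a b := by
    rw [← hcd, hB, σ.injective.mem_set_image]
  have hcd' : c ≤ d := ((hmem a).mpr ha).1.trans ((hmem a).mpr ha).2
  -- Collapse the block to a point among positions (`u`) and among values (`v`). Since `σ` carries
  -- `[a, b]` onto `[c, d]`, the kernels of `u` and `v ∘ σ` coincide, and the quotient permutation
  -- `e` matches them.
  obtain ⟨l, u, hum, hus, huk⟩ := exists_monotone_surjective (monotone_collapse a b)
  obtain ⟨l', v, hvm, hvs, hvk⟩ := exists_monotone_surjective (monotone_collapse c d)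
  have hker (x y : Fin m) : u x = u y ↔ (v ∘ σ) x = (v ∘ σ) y := by
    rw [huk, collapse_eq_iff hab, Function.comp_apply, Function.comp_apply, hvk,
      collapse_eq_iff hcd', hmem, hmem, σ.injective.eq_iff]
  obtain ⟨e, he⟩ := exists_perm_of_ker hus (hvs.comp σ.surjective) hker
  obtain rfl : l = l' := by simpa using Fintype.card_congr e
  have huk' (x y : Fin m) : u x = u y ↔ x = y ∨ (x ∈ Set.Icc a b ∧ y ∈ Set.Icc a b) :=
    (huk x y).trans (collapse_eq_iff hab x y)
  refine ⟨l, u, e, ?_, ?_, hum, hus, ?_⟩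
  · obtain ⟨x, hx⟩ := (Set.ne_univ_iff_exists_notMem B).mp hu
    rw [hB] at hx
    rw [← Fin.nontrivial_iff_two_le]
    refine ⟨u x, u a, fun h => ?_⟩
    rcases (huk' x a).mp h with rfl | h
    · exact hx ha
    · exact hx h.1
  · have hinj : ¬ Function.Injective u := by
      intro hinj
      refine hs ⟨a, ?_⟩
      rw [hB]
      refine Set.Subset.antisymm (fun x hx => ?_) (by simpa using hab)
      exact hinj ((huk' x a).mpr (Or.inr ⟨hx, ha⟩))
    simpa using Fintype.card_lt_of_surjective_not_injective u hus hinj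
  · have : (e : Fin l → Fin l) ∘ u ∘ σ.symm = v := by
      ext x
      simp [he]
    rw [this]
    exact hvm

theorem isSumDecomposable_of_isQuotient_refl {n : ℕ} {π : Perm (Fin n)} {g : Fin n → Fin 2}
    (h : IsQuotient π g (Equiv.refl _)) : IsSumDecomposable π := by
  classical
  -- Both sides are monotone rearrangements of `g`, hence equal; so `π` preserves the fibres of `g`,
  -- and the cut is at the first position with `g = 1`.
  have h1 : g ∘ π.symm = g := by
    have h2 : Monotone (g ∘ π.symm) := h.mono'
    rw [← Tuple.comp_sort_eq_comp_iff_monotone] at h2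
    have h3 : Monotone (g ∘ Equiv.refl _) := h.mono
    rw [← Tuple.comp_sort_eq_comp_iff_monotone] at h3
    rw [h2, ← h3]
    rfl
  have h2 (x : Fin n) : g (π x) = g x := by
    conv_lhs => rw [← h1]
    simp
  obtain ⟨p0, hp0⟩ := h.surj 0
  obtain ⟨p1, hp1⟩ := h.surj 1
  obtain ⟨p, hp, hmin⟩ := Finset.exists_minimal (s := Finset.univ.filter fun x => g x = 1)
    ⟨p1, by simpa using hp1⟩
  simp only [Finset.mem_filter, Finset.mem_univ, true_and] at hp hmin
  have key (x : Fin n) : x < p ↔ g x = 0 := by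
    constructor
    · intro hx
      by_contra h0
      have := hmin (by omega) hx.le
      exact absurd hx (not_lt.mpr this)
    · intro hx
      refine h.mono.reflect_lt ?_
      rw [hx, hp]
      exact Fin.zero_lt_one
  refine ⟨p, ?_, p.2, fun i hi => ?_⟩
  · exact lt_of_le_of_lt (Nat.zero_le _) (Fin.lt_def.mp ((key p0).mpr hp0))
  · exact Fin.lt_def.mp ((key _).mpr ((h2 i).trans ((key i).mp (Fin.lt_def.mpr hi))))

theorem isSumDecomposable_or_of_isQuotient_two {n : ℕ} {π : Perm (Fin n)} {g : Fin n → Fin 2}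
    {σ : Perm (Fin 2)} (h : IsQuotient π g σ) :
    IsSumDecomposable π ∨ IsSumDecomposable (valueRev π) := by
  have hσ : σ = Equiv.refl _ ∨ σ = Fin.revPerm := by
    clear h
    revert σ
    decide
  rcases hσ with rfl | rfl
  · exact Or.inl (isSumDecomposable_of_isQuotient_refl h)
  · refine Or.inr (isSumDecomposable_of_isQuotient_refl (g := g) ⟨h.mono, h.surj, ?_⟩)
    have : (Equiv.refl (Fin 2)) ∘ g ∘ (valueRev π).symm =
        Fin.rev ∘ ((Fin.revPerm : Perm (Fin 2)) ∘ g ∘ π.symm) ∘ Fin.rev := by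
      ext x
      simp [valueRev]
    rw [this]
    exact Fin.rev_anti.comp (h.mono'.comp_antitone Fin.rev_anti)

theorem IsSimple.ne_three {m : ℕ} {σ : Perm (Fin m)} (hσ : IsSimple σ) : m ≠ 3 := by
  rintro rfl
  have h0 := hσ.not_extreme le_rfl (a := 0) (Or.inl fun b _ => Fin.zero_le b)
  have h2 := hσ.not_extreme le_rfl (a := 2) (Or.inr fun b _ => Fin.le_last b)
  have key (b : Fin 3) (hb : ¬ (IsMin b ∨ IsMax b)) : b = 1 := by
    rw [not_or] at hb
    have h3 : b ≠ 0 := fun h => hb.1 (h ▸ fun b _ => Fin.zero_le b)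
    have h4 : b ≠ 2 := fun h => hb.2 (h ▸ fun b _ => Fin.le_last b)
    omega
  have := σ.injective ((key _ h0).trans (key _ h2).symm)
  exact absurd this (by decide)

/-- A permutation of length at least two is sum decomposable, skew decomposable, or an inflation
of a simple permutation of length at least four. -/
theorem exists_isQuotient {n : ℕ} (hn : 2 ≤ n) {π : Perm (Fin n)} (h1 : ¬ IsSumDecomposable π)
    (h2 : ¬ IsSumDecomposable (valueRev π)) :
    ∃ (m : ℕ) (g : Fin n → Fin m) (σ : Perm (Fin m)),
      4 ≤ m ∧ m ≤ n ∧ IsSimple σ ∧ IsQuotient π g σ := by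
  classical
  -- A quotient of least length at least two is simple, since otherwise it could be collapsed
  -- further. Length two means sum or skew decomposable, and there is no simple permutation of
  -- length three.
  have hex : ∃ m, 2 ≤ m ∧ ∃ (g : Fin n → Fin m) (σ : Perm (Fin m)), IsQuotient π g σ := by
    refine ⟨n, hn, id, π, monotone_id, Function.surjective_id, ?_⟩
    have : π ∘ id ∘ π.symm = id := by
      ext x
      simp
    rw [this]
    exact monotone_id
  obtain ⟨hm, g, σ, hq⟩ := Nat.find_spec hex
  have hmin : ∀ l < Nat.find hex, ¬ _ := fun l hl => Nat.find_min hex hl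
  generalize Nat.find hex = m at *
  have hσ : IsSimple σ := by
    by_contra hσ
    obtain ⟨l, u, τ, hl, hlm, hu⟩ := exists_isQuotient_of_not_isSimple hσ
    exact hmin l hlm ⟨hl, u ∘ g, τ, hq.trans hu⟩
  refine ⟨m, g, σ, ?_, by simpa using Fintype.card_le_of_surjective g hq.surj, hσ, hq⟩
  have h3 := hσ.ne_three
  have h4 : m ≠ 2 := by
    rintro rfl
    exact (isSumDecomposable_or_of_isQuotient_two hq).elim h1 h2
  omega

/-! ### Counting permutations by their quotients -/

/-- The condition says `f ∘ π⁻¹ = f ∘ sort f`, so `π⁻¹` ranges over a coset of the stabilizer of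
`f`. -/
theorem card_monotone_comp_symm {n m : ℕ} (f : Fin n → Fin m) :
    Nat.card {π : Perm (Fin n) // Monotone (f ∘ π.symm)} =
      ∏ i, (Fintype.card {a // f a = i}).factorial := by
  classical
  rw [← DomMulAct.stabilizer_card f, ← Nat.card_eq_fintype_card]
  refine Nat.card_congr (Equiv.subtypeEquiv
    ((Equiv.inv (Perm (Fin n))).trans (Equiv.mulRight (Tuple.sort f)⁻¹)) fun π => ?_)
  rw [← Tuple.comp_sort_eq_comp_iff_monotone]
  constructor
  · intro h
    funext x
    have := congrFun h ((Tuple.sort f).symm x)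
    rwa [Function.comp_apply, Function.comp_apply, Equiv.apply_symm_apply] at this
  · intro h
    funext x
    have : f (π.symm ((Tuple.sort f).symm (Tuple.sort f x))) = f (Tuple.sort f x) :=
      congrFun h (Tuple.sort f x)
    rwa [Equiv.symm_apply_apply] at this

theorem card_isQuotient {n m : ℕ} {g : Fin n → Fin m} (hg : Monotone g)
    (hs : Function.Surjective g) (σ : Perm (Fin m)) :
    Nat.card {π : Perm (Fin n) // IsQuotient π g σ} =
      ∏ i, (Fintype.card {a // g a = i}).factorial := by
  classical
  have h1 : Nat.card {π : Perm (Fin n) // IsQuotient π g σ} =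
      Nat.card {π : Perm (Fin n) // Monotone ((σ ∘ g) ∘ π.symm)} :=
    Nat.card_congr (Equiv.subtypeEquivRight fun π => ⟨fun h => h.mono', fun h => ⟨hg, hs, h⟩⟩)
  rw [h1, card_monotone_comp_symm, ← Equiv.prod_comp σ]
  refine Finset.prod_congr rfl fun i _ => ?_
  congr 1
  exact Fintype.card_congr (Equiv.subtypeEquivRight fun a => by simp)

theorem eq_of_monotone_of_card_fiber {n m : ℕ} {g g' : Fin n → Fin m} (hg : Monotone g)
    (hg' : Monotone g')
    (h : ∀ i, Fintype.card {a // g a = i} = Fintype.card {a // g' a = i}) : g = g' := by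
  set ρ : Perm (Fin n) := (Equiv.sigmaFiberEquiv g).symm.trans
    ((Equiv.sigmaCongrRight fun i => Fintype.equivOfCardEq (h i)).trans (Equiv.sigmaFiberEquiv g'))
  have h1 : g' ∘ ρ = g := by
    funext x
    exact (Fintype.equivOfCardEq (h (g x)) ⟨x, rfl⟩).2
  have h2 := Tuple.comp_sort_eq_comp_iff_monotone.mpr (h1.symm ▸ hg : Monotone (g' ∘ ρ))
  have h3 := Tuple.comp_sort_eq_comp_iff_monotone (f := g') (σ := Equiv.refl _) |>.mpr hg'
  rw [h1] at h2
  rw [h2, ← h3]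
  rfl

theorem exists_monotone_of_sum_eq {n m : ℕ} {l : Fin m → ℕ} (hl : ∑ i, l i = n) :
    ∃ g : Fin n → Fin m, Monotone g ∧ ∀ i, Fintype.card {a // g a = i} = l i := by
  subst hl
  set f : Fin (∑ i, l i) → Fin m := fun a => (finSigmaFinEquiv.symm a).1
  refine ⟨f ∘ Tuple.sort f, Tuple.monotone_sort f, fun i => ?_⟩
  have h1 : Fintype.card {a // (f ∘ Tuple.sort f) a = i} = Fintype.card {a // f a = i} :=
    Fintype.card_congr (Equiv.subtypeEquiv (Tuple.sort f) fun a => Iff.rfl)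
  have h2 : Fintype.card {a // f a = i} =
      Fintype.card {p : (Σ i : Fin m, Fin (l i)) // p.1 = i} :=
    Fintype.card_congr (Equiv.subtypeEquiv finSigmaFinEquiv.symm fun a => Iff.rfl)
  rw [h1, h2, Fintype.card_congr (Equiv.sigmaSubtype i), Fintype.card_fin]

open Classical in
-- Fibre sizes identify monotone surjections with compositions of `n` into `m` positive parts;
-- tuples with a zero part contribute nothing because `F` has zero constant term.
theorem coeff_factorialSeries_pow (n m : ℕ) :
    coeff n (factorialSeries ^ m) =
      ∑ g ∈ Finset.univ.filter (fun g : Fin n → Fin m => Monotone g ∧ Function.Surjective g),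
        ∏ i, ((Fintype.card {a // g a = i}).factorial : ℂ) := by
  have h1 : factorialSeries ^ m = ∏ _i : Fin m, factorialSeries := by simp
  rw [h1, coeff_prod]
  symm
  refine Finset.sum_of_injOn
    (fun g => Finsupp.equivFunOnFinite.symm fun i => Fintype.card {a // g a = i}) ?_ ?_ ?_ ?_
  · intro g hg g' hg' h
    simp only [Finset.coe_filter, Finset.mem_univ, true_and, Set.mem_ofPred] at hg hg'
    exact eq_of_monotone_of_card_fiber hg.1 hg'.1 fun i => DFunLike.congr_fun h i
  · intro g _
    rw [Finset.mem_coe, Finset.mem_finsuppAntidiag]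
    refine ⟨?_, Finset.subset_univ _⟩
    have := Fintype.card_congr (Equiv.sigmaFiberEquiv g)
    rw [Fintype.card_sigma, Fintype.card_fin] at this
    simpa using this
  · intro l hl hnot
    rw [Finset.mem_finsuppAntidiag] at hl
    by_contra hne
    have hl0 (i : Fin m) : l i ≠ 0 := fun h0 => hne (Finset.prod_eq_zero (Finset.mem_univ i) (by
      rw [h0, coeff_zero_eq_constantCoeff_apply, constantCoeff_factorialSeries]))
    obtain ⟨g, hg, hgl⟩ := exists_monotone_of_sum_eq hl.1
    refine hnot ⟨g, ?_, Finsupp.ext hgl⟩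
    simp only [Finset.coe_filter, Finset.mem_univ, true_and, Set.mem_ofPred]
    refine ⟨hg, fun i => ?_⟩
    have : 0 < Fintype.card {a // g a = i} := by
      rw [hgl]; exact Nat.pos_of_ne_zero (hl0 i)
    obtain ⟨a, ha⟩ := Fintype.card_pos_iff.mp this
    exact ⟨a, ha⟩
  · intro g hg
    simp only [Finset.mem_filter, Finset.mem_univ, true_and] at hg
    refine Finset.prod_congr rfl fun i _ => ?_
    obtain ⟨a, ha⟩ := hg.2 i
    have : 0 < Fintype.card {a // g a = i} := Fintype.card_pos_iff.mpr ⟨⟨a, ha⟩⟩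
    rw [coeff_factorialSeries]
    · rfl
    · exact this.ne'

open Classical in
theorem card_exists_isQuotient (n m : ℕ) (hm : 3 ≤ m) :
    ((Finset.univ.filter fun π : Perm (Fin n) => ∃ (g : Fin n → Fin m) (σ : Perm (Fin m)),
      IsSimple σ ∧ IsQuotient π g σ).card : ℂ) =
      numSimple m * coeff n (factorialSeries ^ m) := by
  set S := Finset.univ.filter fun σ : Perm (Fin m) => IsSimple σ
  set G := Finset.univ.filter fun g : Fin n → Fin m => Monotone g ∧ Function.Surjective g
  have h1 : (Finset.univ.filter fun π : Perm (Fin n) => ∃ (g : Fin n → Fin m) (σ : Perm (Fin m)),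
      IsSimple σ ∧ IsQuotient π g σ) =
      (S ×ˢ G).biUnion fun p => Finset.univ.filter fun π => IsQuotient π p.2 p.1 := by
    ext π
    simp only [S, G, Finset.mem_filter, Finset.mem_univ, true_and, Finset.mem_biUnion,
      Finset.mem_product, Prod.exists]
    constructor
    · rintro ⟨g, σ, hσ, h⟩
      exact ⟨σ, g, ⟨hσ, h.mono, h.surj⟩, h⟩
    · rintro ⟨σ, g, ⟨hσ, -⟩, h⟩
      exact ⟨g, σ, hσ, h⟩
  rw [h1, Finset.card_biUnion]
  · have hS : numSimple m = S.card := by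
      rw [numSimple, Nat.card_eq_fintype_card, Fintype.card_subtype]
    rw [Finset.sum_product, coeff_factorialSeries_pow, hS, ← nsmul_eq_mul, ← Finset.sum_const]
    push_cast
    refine Finset.sum_congr rfl fun σ _ => Finset.sum_congr rfl fun g hg => ?_
    simp only [Finset.mem_filter, Finset.mem_univ, true_and] at hg
    rw [← Fintype.card_subtype, ← Nat.card_eq_fintype_card, card_isQuotient hg.1 hg.2]
    push_cast
    rfl
  · rintro ⟨σ, g⟩ hp ⟨σ', g'⟩ hp' hne
    rw [Function.onFun, Finset.disjoint_left]
    intro π h h'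
    simp only [S, G, Finset.mem_coe, Finset.mem_product, Finset.mem_filter, Finset.mem_univ,
      true_and] at hp hp' h h'
    obtain ⟨e, he1, he2⟩ := h.unique h' hp.1 hp'.1 hm hm
    exact hne (by rw [he1, he2])

open Classical in
-- The trichotomy is disjoint and exhaustive; reversing values matches the sum decomposable class
-- with the skew decomposable one, whence the factor 2.
theorem factorial_eq_card_isSumDecomposable {n : ℕ} (hn : 2 ≤ n) :
    (n.factorial : ℂ) =
      2 * ((Finset.univ.filter fun π : Perm (Fin n) => IsSumDecomposable π).card : ℂ) +
        ∑ m ∈ Finset.Icc 4 n, numSimple m * coeff n (factorialSeries ^ m) := by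
  set A := Finset.univ.filter fun π : Perm (Fin n) => IsSumDecomposable π with hA
  set B := Finset.univ.filter fun π : Perm (Fin n) => IsSumDecomposable (valueRev π) with hB
  set T : ℕ → Finset (Perm (Fin n)) := fun m => Finset.univ.filter fun π : Perm (Fin n) =>
    ∃ (g : Fin n → Fin m) (σ : Perm (Fin m)), IsSimple σ ∧ IsQuotient π g σ with hT
  have hAB : B.card = A.card := by
    have hrr (π : Perm (Fin n)) : valueRev (valueRev π) = π := by
      ext i
      simp [valueRev_apply]
    refine Finset.card_bij' (fun π _ => valueRev π) (fun π _ => valueRev π) ?_ ?_ ?_ ?_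
    · intro π hπ
      simpa [hA, hB] using hπ
    · intro π hπ
      simpa [hA, hB, hrr] using hπ
    · intro π _
      exact hrr π
    · intro π _
      exact hrr π
  have hun : (Finset.univ : Finset (Perm (Fin n))) =
      (A ∪ B) ∪ (Finset.Icc 4 n).biUnion T := by
    symm
    rw [Finset.eq_univ_iff_forall]
    intro π
    simp only [hA, hB, hT, Finset.mem_union, Finset.mem_filter, Finset.mem_univ, true_and,
      Finset.mem_biUnion, Finset.mem_Icc]
    by_contra hcon
    rw [not_or, not_or] at hcon
    obtain ⟨m, g, σ, hm, hmn, hσ, h⟩ := exists_isQuotient hn hcon.1.1 hcon.1.2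
    exact hcon.2 ⟨m, ⟨hm, hmn⟩, g, σ, hσ, h⟩
  have hdis1 : Disjoint A B := by
    rw [Finset.disjoint_left]
    intro π h h'
    simp only [hA, hB, Finset.mem_filter, Finset.mem_univ, true_and] at h h'
    exact not_isSumDecomposable_and_valueRev π h h'
  have hdis2 : Disjoint (A ∪ B) ((Finset.Icc 4 n).biUnion T) := by
    rw [Finset.disjoint_left]
    intro π h h'
    simp only [hA, hB, hT, Finset.mem_union, Finset.mem_filter, Finset.mem_univ, true_and,
      Finset.mem_biUnion, Finset.mem_Icc] at h h'
    obtain ⟨m, ⟨hm, -⟩, g, σ, hσ, hq⟩ := h'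
    exact h.elim (hq.not_isSumDecomposable hσ (by omega))
      (hq.not_isSumDecomposable_valueRev hσ (by omega))
  have hcard : n.factorial = (Finset.univ : Finset (Perm (Fin n))).card := by
    rw [Finset.card_univ, Fintype.card_perm, Fintype.card_fin]
  rw [hcard, hun, Finset.card_union_of_disjoint hdis2, Finset.card_union_of_disjoint hdis1, hAB,
    Finset.card_biUnion]
  · push_cast
    rw [← two_mul]
    congr 1
    refine Finset.sum_congr rfl fun m hm => ?_
    exact card_exists_isQuotient n m (by have := (Finset.mem_Icc.mp hm).1; omega)
  · intro m hm m' hm' hne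
    rw [Function.onFun, Finset.disjoint_left]
    intro π h h'
    simp only [hT, Finset.mem_filter, Finset.mem_univ, true_and] at h h'
    obtain ⟨g, σ, hσ, hq⟩ := h
    obtain ⟨g', σ', hσ', hq'⟩ := h'
    have h4 := (Finset.mem_Icc.mp hm).1
    have h4' := (Finset.mem_Icc.mp hm').1
    obtain ⟨e, -⟩ := hq.unique hq' hσ hσ' (by omega) (by omega)
    exact hne e

open Classical in
theorem card_isSumDecomposable (n : ℕ) :
    ((Finset.univ.filter fun π : Perm (Fin n) => IsSumDecomposable π).card : ℂ) =
      n.factorial - numPlusIndec n := by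
  have h1 := Finset.card_filter_add_card_filter_not (s := (Finset.univ : Finset (Perm (Fin n))))
    (fun π => IsSumDecomposable π)
  have h2 : numPlusIndec n =
      (Finset.univ.filter fun π : Perm (Fin n) => ¬ IsSumDecomposable π).card := by
    rw [numPlusIndec, Nat.card_eq_fintype_card, Fintype.card_subtype]
    congr 1
    ext π
    simp [isPlusIndecomposable_iff]
  rw [Finset.card_univ, Fintype.card_perm, Fintype.card_fin] at h1
  rw [h2, ← h1]
  push_cast
  ring

end Permutations

/-! ### Generating functions -/

theorem coeff_subst_factorialSeries (f : ℂ⟦X⟧) (n : ℕ) :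
    coeff n (f.subst factorialSeries) =
      ∑ m ∈ Finset.range (n + 1), coeff m f * coeff n (factorialSeries ^ m) := by
  rw [coeff_subst' hasSubst_factorialSeries]
  refine finsum_eq_sum_of_support_subset _ fun m hm => ?_
  rw [Finset.coe_range, Set.mem_Iio]
  by_contra hlt
  refine hm ?_
  have h1 : (X : ℂ⟦X⟧) ^ m ∣ factorialSeries ^ m :=
    pow_dvd_pow_of_dvd (X_dvd_iff.mpr constantCoeff_factorialSeries) m
  simp only [X_pow_dvd_iff.mp h1 n (by omega), smul_zero]

theorem simpleSeries_subst_factorialSeries :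
    simpleSeries.subst factorialSeries =
      2 * genFun (fun n => (numPlusIndec n : ℂ)) - factorialSeries - X := by
  have h2 (n : ℕ) : coeff n (2 * genFun fun n => (numPlusIndec n : ℂ)) =
      2 * coeff n (genFun fun n => (numPlusIndec n : ℂ)) := by
    rw [two_mul, two_mul, map_add]
  have hs (n : ℕ) : coeff n (simpleSeries.subst factorialSeries) =
      ∑ m ∈ Finset.Icc 4 n, numSimple m * coeff n (factorialSeries ^ m) := by
    rw [coeff_subst_factorialSeries]
    symm
    refine Finset.sum_subset_zero_on_sdiff (fun m hm => ?_) (fun m hm => ?_) fun m hm => ?_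
    · rw [Finset.mem_Icc] at hm
      rw [Finset.mem_range]
      omega
    · rw [Finset.mem_sdiff, Finset.mem_range, Finset.mem_Icc] at hm
      rw [simpleSeries, coeff_mk, if_pos (by omega), zero_mul]
    · rw [Finset.mem_Icc] at hm
      rw [simpleSeries, coeff_mk, if_neg (by omega)]
  ext n
  rw [hs, map_sub, map_sub, h2]
  rcases n with _ | _ | n
  -- The trichotomy needs length at least two, so indices `0` and `1` are checked by hand; the term
  -- `-X` is the correction at index `1`.
  · simp [genFun, constantCoeff_factorialSeries]
  · have h1 := factorial_eq_sum_numPlusIndec (n := 1) one_pos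
    simp only [Finset.Icc_self, Finset.sum_singleton, Nat.factorial_one, Nat.sub_self,
      Nat.factorial_zero, mul_one] at h1
    rw [coeff_genFun_of_pos _ (by omega), coeff_factorialSeries (by omega)]
    simp [← h1]
    norm_num
  · have h1 := factorial_eq_card_isSumDecomposable (n := n + 2) (by omega)
    rw [card_isSumDecomposable] at h1
    rw [coeff_genFun_of_pos _ (by omega), coeff_factorialSeries (by omega), coeff_X,
      if_neg (by omega)]
    linear_combination -h1

/-- Multiplying `S(F) = 2I - F - x` by `1 + F` removes `I`; substituting `C` then sends `F` to `x`,
`x` to `C` and `S(F)` to `S`. -/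
theorem one_add_X_mul_comtetSeries_add_simpleSeries :
    (1 + X) * (comtetSeries + simpleSeries) = X - X ^ 2 := by
  have hF := hasSubst_factorialSeries
  have hC := hasSubst_comtetSeries
  have h1 : (1 + factorialSeries) * (simpleSeries.subst factorialSeries + factorialSeries + X) =
      factorialSeries + factorialSeries := by
    rw [simpleSeries_subst_factorialSeries]
    linear_combination 2 * genFun_numPlusIndec_mul
  have h2 := congrArg (PowerSeries.subst comtetSeries) h1
  have hone : (1 : ℂ⟦X⟧).subst comtetSeries = (1 : ℂ⟦X⟧) := by
    rw [← coe_substAlgHom hC, map_one]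
  rw [subst_mul hC, subst_add hC, subst_add hC, subst_add hC, subst_add hC,
    subst_comp_subst_apply hF hC, subst_X hC, subst_comtetSeries_factorialSeries, X_subst,
    hone] at h2
  linear_combination h2

theorem isRatSeries_comtetSeries_add_simpleSeries :
    IsRatSeries (comtetSeries + simpleSeries) := by
  refine ⟨1 + Polynomial.X, Polynomial.X - Polynomial.X ^ 2, ?_, ?_⟩
  · rw [add_comm, ← Polynomial.C_1]
    exact Polynomial.X_add_C_ne_zero 1
  · push_cast
    exact one_add_X_mul_comtetSeries_add_simpleSeries

theorem genFun_com : genFun com = comtetSeries := by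
  ext n
  rcases Nat.eq_zero_or_pos n with rfl | hn
  · rw [coeff_zero_genFun, coeff_zero_eq_constantCoeff_apply, constantCoeff_comtetSeries]
  · rw [coeff_genFun_of_pos _ hn.ne', com]

theorem genFun_numSimple : genFun (fun n => (numSimple n : ℂ)) =
    simpleSeries + (trunc 4 (genFun fun n => (numSimple n : ℂ)) : Polynomial ℂ) := by
  ext n
  rw [map_add, Polynomial.coeff_coe, coeff_trunc, simpleSeries, coeff_mk]
  split_ifs with h
  · rw [zero_add]
  · rw [add_zero, coeff_genFun_of_pos _ (by omega)]

/-! ### Non-D-finiteness of the generating functions -/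

theorem genFun_numPlusIndec_not_isDFinite :
    ¬ IsDFinite (genFun fun n => (numPlusIndec n : ℂ)) := fun h =>
  not_isDFiniteModRat_of_mul_one_add genFun_numPlusIndec_mul h.isDFiniteModRat

theorem genFun_com_not_isDFinite : ¬ IsDFinite (genFun com) := fun h =>
  comtetSeries_not_isDFiniteModRat (genFun_com ▸ h.isDFiniteModRat)

theorem simpleSeries_not_isDFinite : ¬ IsDFinite simpleSeries := fun h =>
  comtetSeries_not_isDFiniteModRat (h.isDFiniteModRat.of_add
    (add_comm comtetSeries simpleSeries ▸ isRatSeries_comtetSeries_add_simpleSeries))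

theorem genFun_numSimple_not_isDFinite :
    ¬ IsDFinite (genFun fun n => (numSimple n : ℂ)) := fun h =>
  comtetSeries_not_isDFiniteModRat (h.isDFiniteModRat.of_add (by
    rw [genFun_numSimple, add_right_comm, add_comm simpleSeries]
    exact isRatSeries_comtetSeries_add_simpleSeries.add (IsRatSeries.coe _)))

end SimplePerm

end

theorem mainTheorem3 :
    (¬ SimplePerm.IsPRecursive (fun n => (SimplePerm.numPlusIndec n : ℂ)) ∧
      ¬ SimplePerm.IsPRecursive SimplePerm.com ∧
      ¬ SimplePerm.IsPRecursive (fun n => (SimplePerm.numSimple n : ℂ))) ∧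
    (¬ SimplePerm.IsDFinite (SimplePerm.genFun fun n => (SimplePerm.numPlusIndec n : ℂ)) ∧
      ¬ SimplePerm.IsDFinite (SimplePerm.genFun SimplePerm.com) ∧
      ¬ SimplePerm.IsDFinite (SimplePerm.genFun fun n => (SimplePerm.numSimple n : ℂ)) ∧
      ¬ SimplePerm.IsDFinite SimplePerm.simpleSeries) :=
  ⟨⟨fun h => SimplePerm.genFun_numPlusIndec_not_isDFinite h.isDFinite,
      fun h => SimplePerm.genFun_com_not_isDFinite h.isDFinite,
      fun h => SimplePerm.genFun_numSimple_not_isDFinite h.isDFinite⟩,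
    SimplePerm.genFun_numPlusIndec_not_isDFinite, SimplePerm.genFun_com_not_isDFinite,
    SimplePerm.genFun_numSimple_not_isDFinite, SimplePerm.simpleSeries_not_isDFinite⟩
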